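/- Let $p$ be a prime, $\mathbf{C}_p$ the completion of an algebraic closure $\overline{\mathbf{Q}}_p$ of $\mathbf{Q}_p$, with ring of integers $\mathcal{O}_{\mathbf{C}_p}$ and maximal ideal $\mathfrak{m}_{\mathbf{C}_p}$. Let $S_0(\mathbf{Z}_p)$ be the monoid, under composition, of power series over $\mathbf{Z}_p$ without constant term. Let $f,u\in S_0(\mathbf{Z}_p)$ be such that $f\circ u=u\circ f$; $u$ is invertible of infinite order; $v_p(f'(0))=1$ and $f$ has exactly $p$ roots in $\mathfrak{m}_{\mathbf{C}_p}$; and $v_p(1-u'(0)^m)=v_p(1-u'(0))+v_p(m)$ for all $m$. Let $u^{\circ\mathbf{Z}_p}$ be the closed subgroup of $S_0(\mathbf{Z}_p)$ topologically generated by $u$ (for coefficientwise convergence). Fix a sequence $\pi_1,\pi_2,\dots$ in $\mathfrak{m}_{\mathbf{C}_p}$ with $f(\pi_1)=0$, $\pi_1\neq 0$ and $f(\pi_{i+1})=\pi_i$ for $i\ge 1$. Let $k$ be the largest integer with $u(\pi_k)=\pi_k$, put $K=\mathbf{Q}_p(\pi_k)$, and let $G_K$ be its absolute Galois group. Let $A_\infty$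 be the $p$-adic completion of the colimit of the rings $A_i=\mathbf{Z}_p[[x_i]]$ ($i\ge 1$) along the homomorphisms $A_i\to A_{i+1}$, $x_i\mapsto f(x_{i+1})$; for $g\in\mathbf{Z}_p[[x]]$ write $g(x_i)\in A_\infty$ for the image of $g(x_i)\in A_i$. Let $\widetilde{\mathbf{E}}^+=\varprojlim_{x\mapsto x^p}\mathcal{O}_{\mathbf{C}_p}/p$ and $\widetilde{\mathbf{A}}^+=W(\widetilde{\mathbf{E}}^+)$, with their functorial actions of $G_{\mathbf{Q}_p}$. Let $a(x)\in S_0(\mathbf{F}_p)$ be the series whose $n$-th coefficient is the reduction mod $p$ of the coefficient of $x^{pn}$ in $f$ (so that $f(x)\equiv a(x^p)\bmod p$), and let $\hat\pi_i\in\widetilde{\mathbf{E}}^+$ be the element whose $n$-th coordinate ($n\ge 0$) is $a^{\circ n}(\pi_{i+n})\bmod p$. Then: 1. There is a unique ring homomorphism $\varphi:A_\infty\to\widetilde{\mathbf{E}}^+$ with $\varphi(x_i)=\hat\pi_i$ for all $i\ge 1$; its kernel is $pA_\infty$. There is a unique ring homomorphism $\iota:A_\infty\to\widetilde{\mathbf{A}}^+$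 lifting $\varphi$ (that is, whose composite with the projection $W(\widetilde{\mathbf{E}}^+)\to\widetilde{\mathbf{E}}^+$ is $\varphi$), and $\iota$ is injective. 2. For every $\sigma\in G_K$ there is a unique $u_\sigma\in u^{\circ\mathbf{Z}_p}$ with $u_\sigma(\pi_i)=\sigma(\pi_i)$ for all $i\ge 1$; put $\chi_f(\sigma)=u_\sigma'(0)$. There is a unique element $[\chi_f(\sigma)]_f$ of $u^{\circ\mathbf{Z}_p}$ with linear coefficient $\chi_f(\sigma)$. 3. For every $\sigma\in G_K$ the action of $\sigma$ on $\widetilde{\mathbf{A}}^+$ maps $\iota(A_\infty)$ into itself, and, identifying $A_\infty$ with $\iota(A_\infty)$, $$\sigma(x_i)=[\chi_f(\sigma)]_f(x_i)\qquad\text{for all } i\ge 1.$$ -/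

import Mathlib

noncomputable section

namespace HeightOne

open PowerSeries

/-! ### Power series without constant term, as a monoid under composition -/

/-- `S₀(R)`: formal power series over `R` without constant term. -/
structure S0 (R : Type*) [CommRing R] where
  /-- the underlying power series -/
  series : R⟦X⟧
  constantCoeff_series : constantCoeff series = 0

namespace S0

variable {R : Type*} [CommRing R]

theorem ext' {g h : S0 R} (e : g.series = h.series) : g = h := by
  cases g; cases h; cases e; rfl

theorem hasSubst (g : S0 R) : HasSubst g.series :=
  HasSubst.of_constantCoeff_zero' g.constantCoeff_series

/-- The linear coefficient `g'(0)`. -/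
def linearCoeff (g : S0 R) : R := coeff 1 g.series

/-- `S₀(R)` is a monoid under composition, `(g * h)(x) = g(h(x))`, with unit the series `x`. In
particular `g ^ n` is the `n`-fold iterate of `g`, and units are the series which are invertible
under composition. -/
instance : Monoid (S0 R) where
  mul g h := ⟨g.series.subst h.series,
    constantCoeff_subst_eq_zero h.constantCoeff_series _ g.constantCoeff_series⟩
  one := ⟨X, constantCoeff_X⟩
  mul_assoc g h k := ext' (subst_comp_subst_apply h.hasSubst k.hasSubst g.series)
  one_mul g := ext' (subst_X g.hasSubst)
  mul_one g := ext' (X_subst g.series)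

theorem mul_series (g h : S0 R) : (g * h).series = g.series.subst h.series := rfl

theorem one_series : (1 : S0 R).series = X := rfl

/-- Substitution `g(x) ↦ g(h(x))`, as a ring endomorphism of `R⟦x⟧`. -/
def substHom (h : S0 R) : R⟦X⟧ →+* R⟦X⟧ := (substAlgHom (R := R) h.hasSubst).toRingHom

theorem substHom_apply (h : S0 R) (g : R⟦X⟧) : h.substHom g = g.subst h.series :=
  congrFun (coe_substAlgHom h.hasSubst) g

theorem substHom_one (g : R⟦X⟧) : (1 : S0 R).substHom g = g := by
  rw [substHom_apply, one_series]; exact X_subst g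

theorem substHom_mul (h k : S0 R) (g : R⟦X⟧) :
    (h * k).substHom g = k.substHom (h.substHom g) := by
  simp only [substHom_apply, mul_series]
  exact (subst_comp_subst_apply h.hasSubst k.hasSubst g).symm

end S0

variable (p : ℕ) [Fact p.Prime]

/-! ### The ring of integers of `ℂ_p`, and evaluation of power series -/

theorem mem_integers_iff (z : ℂ_[p]) : z ∈ 𝓞_ℂ_[p] ↔ ‖z‖ ≤ 1 := by
  rw [PadicComplex.norm_eq_norm]
  exact (Valuation.mem_valuationSubring_iff _ _).trans
    (Valued.toNormedField.norm_le_one_iff (L := ℂ_[p]) (x := z)).symm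

instance : Fact (¬ IsUnit (p : 𝓞_ℂ_[p])) := ⟨by
  intro h
  obtain ⟨v, hv⟩ := h.exists_right_inv
  have h1 : ((p : ℂ_[p])) * (v : ℂ_[p]) = 1 := by exact_mod_cast congrArg Subtype.val hv
  have h2 : ‖(v : ℂ_[p])‖ ≤ 1 := (mem_integers_iff p _).1 v.2
  have h3 : ‖(p : ℂ_[p])‖ = (p : ℝ)⁻¹ := by
    have := PadicComplex.norm_extends' p (p : ℚ_[p])
    rw [Padic.norm_p] at this
    rw [← this]
    congr 1
    exact (map_natCast (algebraMap ℚ_[p] ℂ_[p]) p).symm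
  have h4 := congrArg norm h1
  rw [norm_mul, norm_one, h3] at h4
  have hp : (1 : ℝ) < p := by exact_mod_cast (Fact.out : p.Prime).one_lt
  have h5 : (p : ℝ)⁻¹ < 1 := inv_lt_one_of_one_lt₀ hp
  have h6 : (0 : ℝ) ≤ ‖(v : ℂ_[p])‖ := norm_nonneg _
  have h7 : (p : ℝ)⁻¹ * ‖(v : ℂ_[p])‖ ≤ (p : ℝ)⁻¹ :=
    mul_le_of_le_one_right (by positivity) h2
  linarith⟩

variable {p}

/-- The value `g(z) = ∑ aₙ zⁿ` of a power series `g` over `ℤ_p` at `z ∈ 𝓞_{ℂ_p}`, the sum being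
taken in `ℂ_p`. It is used only for `‖z‖ < 1`, where the series converges. -/
def evalInt (g : ℤ_[p]⟦X⟧) (z : 𝓞_ℂ_[p]) : 𝓞_ℂ_[p] :=
  ⟨∑' n : ℕ, algebraMap ℚ_[p] ℂ_[p] (coeff n g : ℤ_[p]) * (z : ℂ_[p]) ^ n, by
    have hc : IsClosed ((𝓞_ℂ_[p] : Set ℂ_[p])) := by
      have : (𝓞_ℂ_[p] : Set ℂ_[p]) = {z | ‖z‖ ≤ 1} := Set.ext fun z => mem_integers_iff p z
      rw [this]
      exact isClosed_le continuous_norm continuous_const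
    refine tsum_mem (s := 𝓞_ℂ_[p]) hc fun n => ?_
    refine mul_mem ?_ (pow_mem z.2 n)
    rw [mem_integers_iff, norm_algebraMap']
    exact PadicInt.norm_le_one _⟩

/-! ### The Galois action on `ℂ_p`, `𝓞_{ℂ_p}`, `Ẽ⁺` and `Ã⁺ = W(Ẽ⁺)` -/

theorem isometry_gal (σ : Gal(PadicAlgCl p/ℚ_[p])) : Isometry (σ : PadicAlgCl p → PadicAlgCl p) :=
  AddMonoidHomClass.isometry_of_norm σ fun x => (spectralNorm_eq_of_equiv σ x).symm

/-- The continuous extension to `ℂ_p` of an automorphism of the algebraic closure of `ℚ_p`. -/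
def galC (σ : Gal(PadicAlgCl p/ℚ_[p])) : ℂ_[p] →+* ℂ_[p] :=
  UniformSpace.Completion.mapRingHom (σ : PadicAlgCl p →+* PadicAlgCl p) (isometry_gal σ).continuous

theorem norm_galC (σ : Gal(PadicAlgCl p/ℚ_[p])) (z : ℂ_[p]) : ‖galC σ z‖ = ‖z‖ := by
  have hc : Continuous (galC σ) := UniformSpace.Completion.continuous_map
  induction z using UniformSpace.Completion.induction_on with
  | hp => exact isClosed_eq (continuous_norm.comp hc) continuous_norm
  | ih a =>
    have h : galC σ (a : ℂ_[p]) = ((σ a : PadicAlgCl p) : ℂ_[p]) :=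
      UniformSpace.Completion.mapRingHom_coe (isometry_gal σ).continuous a
    rw [h, PadicComplex.norm_extends, PadicComplex.norm_extends]
    exact (spectralNorm_eq_of_equiv σ a).symm

/-- The action of `σ` on `𝓞_{ℂ_p}`. -/
def galInt (σ : Gal(PadicAlgCl p/ℚ_[p])) : 𝓞_ℂ_[p] →+* 𝓞_ℂ_[p] :=
  (galC σ).restrict 𝓞_ℂ_[p] 𝓞_ℂ_[p] fun z hz => by
    rw [mem_integers_iff] at hz ⊢
    rwa [norm_galC]

/-- The action of `σ` on `𝓞_{ℂ_p}/p`. -/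
def galModP (σ : Gal(PadicAlgCl p/ℚ_[p])) : ModP 𝓞_ℂ_[p] p →+* ModP 𝓞_ℂ_[p] p :=
  Ideal.quotientMap (Ideal.span {(p : 𝓞_ℂ_[p])}) (galInt σ) (by
    rw [Ideal.span_le, Set.singleton_subset_iff]
    change galInt σ (p : 𝓞_ℂ_[p]) ∈ Ideal.span {(p : 𝓞_ℂ_[p])}
    rw [map_natCast]
    exact Ideal.mem_span_singleton_self _)

variable (p) in
/-- `Ẽ⁺`, the inverse limit of `𝓞_{ℂ_p}/p` along the `p`-power map. -/
abbrev Etilde : Type := PreTilt 𝓞_ℂ_[p] p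

variable (p) in
/-- `Ã⁺ = W(Ẽ⁺)`. -/
abbrev Atilde : Type := WittVector p (Etilde p)

/-- The action of `σ` on `Ẽ⁺`, coordinate by coordinate. -/
def galE (σ : Gal(PadicAlgCl p/ℚ_[p])) : Etilde p →+* Etilde p :=
  Perfection.map p (galModP σ)

/-- The action `W(σ)` on `Ã⁺`. -/
def galA (σ : Gal(PadicAlgCl p/ℚ_[p])) : Atilde p →+* Atilde p :=
  WittVector.map (galE σ)

/-! ### The dynamical system -/

/-- `u^{∘ℤ_p}`: the closed subgroup of `S₀(ℤ_p)` topologically generated by `u`, for the topology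
of coefficientwise convergence. -/
def zpIterates (u : (S0 ℤ_[p])ˣ) : Set (S0 ℤ_[p]) :=
  {v | v.series ∈ @closure ℤ_[p]⟦X⟧ (PowerSeries.WithPiTopology.instTopologicalSpace ℤ_[p])
    (Set.range fun n : ℤ => ((u ^ n : (S0 ℤ_[p])ˣ) : S0 ℤ_[p]).series)}

/-- The assumptions on the pair `(f, u)`. In the last one `u'(0)` is assumed to satisfy
`v_p(1 - u'(0)^m) = v_p(1 - u'(0)) + v_p(m)`, written multiplicatively. -/
structure IsHeightOnePair (f : S0 ℤ_[p]) (u : (S0 ℤ_[p])ˣ) : Prop where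
  comm : f * u = u * f
  infinite_order : ∀ n : ℕ, 0 < n → u ^ n ≠ 1
  valuation_linearCoeff : f.linearCoeff.valuation = 1
  ncard_roots : {z : 𝓞_ℂ_[p] | ‖(z : ℂ_[p])‖ < 1 ∧ evalInt f.series z = 0}.ncard = p
  norm_one_sub_pow : ∀ m : ℕ, ‖1 - (u : S0 ℤ_[p]).linearCoeff ^ m‖ =
    ‖1 - (u : S0 ℤ_[p]).linearCoeff‖ * ‖(m : ℤ_[p])‖

/-- `f`-consistent sequences `(s₁, s₂, …)` in the maximal ideal of `𝓞_{ℂ_p}`; the entry `s_{i+1}`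
is `s i`. -/
structure IsConsistent (f : S0 ℤ_[p]) (s : ℕ → 𝓞_ℂ_[p]) : Prop where
  norm_lt_one : ∀ i, ‖(s i : ℂ_[p])‖ < 1
  zero : evalInt f.series (s 0) = 0
  succ : ∀ i, evalInt f.series (s (i + 1)) = s i

/-- The largest index `k` such that `u` fixes the `k`-th entry of `s` (indices starting at `0`). -/
def fixedIndex (u : (S0 ℤ_[p])ˣ) (s : ℕ → 𝓞_ℂ_[p]) : ℕ :=
  sSup {k : ℕ | evalInt (u : S0 ℤ_[p]).series (s k) = s k}

/-- The field `K = ℚ_p(π_k) ⊆ ℂ_p`, where `π_k` is the last entry of `s` fixed by `u`. -/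
def fieldK (u : (S0 ℤ_[p])ˣ) (s : ℕ → 𝓞_ℂ_[p]) : IntermediateField ℚ_[p] ℂ_[p] :=
  IntermediateField.adjoin ℚ_[p] {(s (fixedIndex u s) : ℂ_[p])}

/-- `σ` belongs to the absolute Galois group `G_K` of `K`. -/
def InGK (u : (S0 ℤ_[p])ˣ) (s : ℕ → 𝓞_ℂ_[p]) (σ : Gal(PadicAlgCl p/ℚ_[p])) : Prop :=
  ∀ z ∈ fieldK u s, galC σ z = z

/-- `v = u_σ`: `v` is an element of `u^{∘ℤ_p}` such that `v(π_i) = σ(π_i)` for all `i`. -/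
def IsUSigma (u : (S0 ℤ_[p])ˣ) (s : ℕ → 𝓞_ℂ_[p]) (σ : Gal(PadicAlgCl p/ℚ_[p]))
    (v : S0 ℤ_[p]) : Prop :=
  v ∈ zpIterates u ∧ ∀ i, evalInt v.series (s i) = galInt σ (s i)

/-- `χ_f(σ) = u_σ'(0)`. -/
def chi (u : (S0 ℤ_[p])ˣ) (s : ℕ → 𝓞_ℂ_[p]) (σ : Gal(PadicAlgCl p/ℚ_[p])) : ℤ_[p] :=
  (Classical.epsilon (IsUSigma u s σ)).linearCoeff

/-- `v` is a `ℤ_p`-iterate of `u` with linear coefficient `c`. -/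
def IsBracket (u : (S0 ℤ_[p])ˣ) (c : ℤ_[p]) (v : S0 ℤ_[p]) : Prop :=
  v ∈ zpIterates u ∧ v.linearCoeff = c

/-- `[c]_f`: the `ℤ_p`-iterate of `u` with linear coefficient `c`. -/
def bracket (u : (S0 ℤ_[p])ˣ) (c : ℤ_[p]) : S0 ℤ_[p] :=
  Classical.epsilon (IsBracket u c)

/-! ### The ring `A_∞` -/

/-- The transition map `A_i → A_j`, `x_i ↦ f^{∘(j-i)}(x_j)`, where all `A_i` are `ℤ_p⟦x⟧`. -/
def transition (f : S0 ℤ_[p]) (i j : ℕ) (_ : i ≤ j) : ℤ_[p]⟦X⟧ →+* ℤ_[p]⟦X⟧ :=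
  (f ^ (j - i)).substHom

instance (f : S0 ℤ_[p]) :
    DirectedSystem (fun _ : ℕ => ℤ_[p]⟦X⟧) fun i j h => transition f i j h where
  map_self i g := by simp [transition, S0.substHom_one]
  map_map i j k hij hjk g := by
    simp only [transition]
    rw [← S0.substHom_mul, ← pow_add]
    congr 3
    omega

/-- `A_∞°`, the colimit of the rings `A_i = ℤ_p⟦x_i⟧` along `x_i ↦ f(x_{i+1})`. -/
abbrev AinftyCirc (f : S0 ℤ_[p]) : Type :=
  Ring.DirectLimit (fun _ : ℕ => ℤ_[p]⟦X⟧) fun i j h => transition f i j h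

/-- `A_∞`, the `p`-adic completion of `A_∞°`. -/
abbrev Ainfty (f : S0 ℤ_[p]) : Type :=
  AdicCompletion (Ideal.span {(p : AinftyCirc f)}) (AinftyCirc f)

/-- The canonical map `A_i → A_∞`. As `A_i = ℤ_p⟦x_i⟧`, it sends a power series `g` to the element
`g(x_i)` of `A_∞`. -/
def evalX (f : S0 ℤ_[p]) (i : ℕ) : ℤ_[p]⟦X⟧ →+* Ainfty f :=
  (algebraMap (AinftyCirc f) (Ainfty f)).comp
    (Ring.DirectLimit.of (fun _ : ℕ => ℤ_[p]⟦X⟧) (fun i j h => transition f i j h) i)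

/-- The element `x_i` of `A_∞` (`xvar f i` is the `(i+1)`-st one). -/
def xvar (f : S0 ℤ_[p]) (i : ℕ) : Ainfty f := evalX f i X

/-- A lift to `ℤ_p` of the series `a ∈ S₀(𝔽_p)` such that `f(x) ≡ a(x^p) mod p`: the `n`-th
coefficient is that of `x^{pn}` in `f`. -/
def frobQuotient (f : S0 ℤ_[p]) : S0 ℤ_[p] :=
  ⟨PowerSeries.mk fun n => coeff (p * n) f.series, by
    have := f.constantCoeff_series
    rw [← coeff_zero_eq_constantCoeff_apply] at this ⊢
    simpa using this⟩

/-- `φ` is the homomorphism `A_∞ → Ẽ⁺` attached to the sequence of the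
`π̂_i = ⟨a^{∘(k-i)}(π_k) mod p⟩_{k ≥ i}`, i.e. it maps `x_i` to `π̂_i` for all `i`. The `n`-th
coordinate of `π̂_i` is the entry with `k = i + n`. -/
def IsReduction (f : S0 ℤ_[p]) (s : ℕ → 𝓞_ℂ_[p]) (φ : Ainfty f →+* Etilde p) : Prop :=
  ∀ i n, PreTilt.coeff n (φ (xvar f i)) =
    Ideal.Quotient.mk _ (evalInt (frobQuotient f ^ n).series (s (i + n)))

end HeightOne

end

/-!
Write `D` for the open unit disc of `ℂ_p`, on which `S₀(ℤ_p)` acts, and call a series *Eisenstein*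
if its constant term has norm `1/p` and it is nonzero modulo `p`. By Weierstrass preparation, such
a series is the product of a unit and of an Eisenstein polynomial, so that its zeros in `D` are
simple, are permuted transitively by the Galois group, and are as many as its order modulo `p`; a
series vanishing at one of them is a multiple of it (`IsEisensteinSeries`). The hypotheses on `f`
say that `f(x)/x` is Eisenstein of order `p - 1` modulo `p`
(`IsHeightOnePair.isEisensteinSeries_divX`, `IsHeightOnePair.order_red_divX`), and then
`f^{∘(n+1)}/f^{∘n}` is Eisenstein of order `p^n (p - 1)` modulo `p`; its zeros are the possible
values of the entry `s n` (`levelSeries`).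

*The series `u_σ`.* Let `j` be the last index such that `u` fixes `s j`. The hypothesis on
`1 - u'(0)^m` shows that `u^{p^i}` fixes `s (j + i)` and not `s (j + i + 1)`, so that the orbits of
`u` on the fibres of `f` are as large as the fibres, and if `σ` fixes `s j` then for each `i` some
power of `u` has the same value as `σ` at `s 0, …, s i`. By compactness `u_σ` exists
(`IsHeightOnePair.exists_isUSigma`). It is unique since a series commuting with `f` is determined
by its linear coefficient (`eq_of_commute`), which is determined by the values at the `s i`
(`eq_of_smul_seq_eq`).

*The homomorphism `φ`.* The derivative of `f` vanishes modulo `p`: otherwise it would be Eisenstein,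
and one of its zeros would be a multiple root of an iterate of `f` (`red_derivative_eq_zero`). So
`f(x) ≡ a(x^p)`, and since the Frobenius of `𝔽_p⟦x⟧` is the substitution `x ↦ x^p`, a series
commuting with `f` commutes with `a` modulo `p` (`commute_red_frobQuotient`). Hence the
`g ↦ (g(a^{∘n}(s (i + n))) mod p)_n` are compatible homomorphisms `A_i → Ẽ⁺`; they define `φ`
(`phi`). Modulo `p`, a nonzero series is a power of `x` times a unit; as `Ẽ⁺` is reduced and
`p ∤ s m` for `m ≥ 1`, the kernel of `φ` is generated by `p` (`ker_phi`). Uniqueness holds because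
ring homomorphisms out of a power series ring are automatically continuous
(`powerSeries_ringHom_ext`).

*The homomorphism `ι`.* `A_∞` is `p`-adically complete and `p`-torsion free, and `A_∞/p` is perfect,
because `x_i = f(x_{i+1}) ≡ a(x_{i+1})^p`. For such rings Fontaine's homomorphism
`θ : W(A_∞^♭) → A_∞` is bijective, so that `φ` lifts to `W(Ẽ⁺)`
(`exists_constantCoeff_comp_eq`). Perfectness also gives the uniqueness of lifts
(`eq_of_constantCoeff_comp_eq`).

*The Galois action.* The series `u_σ` induces an endomorphism `U` of `A_∞`, `g(x_i) ↦ g(u_σ(x_i))`.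
The homomorphisms `σ ∘ ι` and `ι ∘ U` are equal modulo `p` (`galE_comp_phi`), hence equal by the
uniqueness of lifts.
-/

noncomputable section

namespace HeightOne

open PowerSeries

/-! ### Ring homomorphisms out of a power series ring -/

/-- Automatic continuity: two ring homomorphisms out of `R⟦X⟧` which agree on constants and on `X`
agree, as soon as `0` is the only element of the target divisible by all powers of the image of
`X`. -/
theorem powerSeries_ringHom_ext {R S : Type*} [CommRing R] [CommRing S] {θ θ' : R⟦X⟧ →+* S}
    (hC : ∀ a, θ (C a) = θ' (C a)) (hX : θ X = θ' X)
    (hs : ∀ r, (∀ N, θ X ^ N ∣ r) → r = 0) : θ = θ' := by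
  ext g
  rw [← sub_eq_zero]
  refine hs _ fun N => ?_
  have hpoly : θ.comp Polynomial.coeToPowerSeries.ringHom =
      θ'.comp Polynomial.coeToPowerSeries.ringHom := by
    apply Polynomial.ringHom_ext
    · intro a; simpa using hC a
    · simpa using hX
  have h := congrArg (fun φ => φ (trunc N g)) hpoly
  simp only [RingHom.comp_apply, Polynomial.coeToPowerSeries.ringHom_apply] at h
  rw [eq_X_pow_mul_shift_add_trunc N g, map_add, map_add, h, add_sub_add_right_eq_sub,
    map_mul, map_mul, map_pow, map_pow, ← hX, ← mul_sub]
  exact dvd_mul_right _ _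

/-- Any two ring homomorphisms from `ℤ_p` to a ring of characteristic `p` agree. -/
theorem padicInt_ringHom_ext_of_charP {p : ℕ} [Fact p.Prime] {S : Type*} [CommRing S] [CharP S p]
    (θ θ' : ℤ_[p] →+* S) : θ = θ' := by
  ext a
  obtain ⟨n, hn⟩ : ∃ n : ℕ, a - n ∈ IsLocalRing.maximalIdeal ℤ_[p] :=
    ⟨_, PadicInt.sub_zmodRepr_mem (x := a)⟩
  rw [PadicInt.maximalIdeal_eq_span_p, Ideal.mem_span_singleton] at hn
  obtain ⟨b, hb⟩ := hn
  obtain rfl := sub_eq_iff_eq_add.1 hb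
  simp

variable {p : ℕ} [Fact p.Prime]

/-! ### Evaluation on the open unit disc -/

theorem norm_le_one (z : 𝓞_ℂ_[p]) : ‖(z : ℂ_[p])‖ ≤ 1 := (mem_integers_iff p _).1 z.2

theorem norm_coe_p : ‖(p : ℂ_[p])‖ = (p : ℝ)⁻¹ := by
  rw [← map_natCast (algebraMap ℚ_[p] ℂ_[p]) p, norm_algebraMap', Padic.norm_p]

theorem prime_inv_lt_one : (p : ℝ)⁻¹ < 1 :=
  inv_lt_one_of_one_lt₀ (by exact_mod_cast (Fact.out : p.Prime).one_lt)

theorem prime_inv_pos : 0 < (p : ℝ)⁻¹ :=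
  inv_pos.2 (by exact_mod_cast (Fact.out : p.Prime).pos)

theorem integers_dvd_iff (z w : 𝓞_ℂ_[p]) : z ∣ w ↔ ‖(w : ℂ_[p])‖ ≤ ‖(z : ℂ_[p])‖ := by
  constructor
  · rintro ⟨v, rfl⟩
    push_cast
    rw [norm_mul]
    exact mul_le_of_le_one_right (norm_nonneg _) (norm_le_one v)
  · intro h
    by_cases hz : (z : ℂ_[p]) = 0
    · rw [hz, norm_zero] at h
      have : w = 0 := Subtype.ext (norm_le_zero_iff.1 h)
      rw [this]; exact dvd_zero z
    · refine ⟨⟨(w : ℂ_[p]) / z, ?_⟩, Subtype.ext ?_⟩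
      · rw [mem_integers_iff, norm_div]
        exact div_le_one_of_le₀ h (norm_nonneg _)
      · push_cast
        rw [mul_div_cancel₀ _ hz]

theorem eq_zero_of_forall_pow_dvd {z r : 𝓞_ℂ_[p]} (hz : ‖(z : ℂ_[p])‖ < 1)
    (h : ∀ N : ℕ, z ^ N ∣ r) : r = 0 := by
  refine Subtype.ext (norm_le_zero_iff.1 ?_)
  refine ge_of_tendsto' (tendsto_pow_atTop_nhds_zero_of_lt_one (norm_nonneg _) hz) fun N => ?_
  have := (integers_dvd_iff _ _).1 (h N)
  push_cast at this
  rwa [norm_pow] at this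

variable (p) in
/-- The inclusion of `ℤ_p` into `ℂ_p`. -/
def toCp : ℤ_[p] →+* ℂ_[p] := (algebraMap ℚ_[p] ℂ_[p]).comp PadicInt.Coe.ringHom

theorem norm_toCp (a : ℤ_[p]) : ‖toCp p a‖ = ‖a‖ := norm_algebraMap' ℂ_[p] (a : ℚ_[p])

theorem coe_evalInt (g : ℤ_[p]⟦X⟧) (z : 𝓞_ℂ_[p]) : (evalInt g z : ℂ_[p]) =
    ∑' n : ℕ, toCp p (coeff n g) * (z : ℂ_[p]) ^ n := rfl

theorem summable_evalInt (g : ℤ_[p]⟦X⟧) {z : 𝓞_ℂ_[p]} (hz : ‖(z : ℂ_[p])‖ < 1) :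
    Summable fun n : ℕ => ‖toCp p (coeff n g) * (z : ℂ_[p]) ^ n‖ := by
  refine Summable.of_nonneg_of_le (fun _ => norm_nonneg _) (fun n => ?_)
    (summable_geometric_of_lt_one (norm_nonneg _) hz)
  rw [norm_mul, norm_pow, norm_toCp]
  exact mul_le_of_le_one_left (by positivity) (PadicInt.norm_le_one _)

variable (p) in
/-- The open unit disc of `ℂ_p`, that is, the maximal ideal of `𝓞_{ℂ_p}`. -/
abbrev Disc : Type := {z : 𝓞_ℂ_[p] // ‖(z : ℂ_[p])‖ < 1}

theorem evalInt_C (a : ℤ_[p]) (z : 𝓞_ℂ_[p]) :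
    (evalInt (C a) z : ℂ_[p]) = toCp p a := by
  rw [coe_evalInt, tsum_eq_single 0]
  · simp
  · intro n hn
    simp [coeff_C, hn]

theorem evalInt_X (z : 𝓞_ℂ_[p]) : evalInt X z = z := by
  refine Subtype.ext ?_
  rw [coe_evalInt, tsum_eq_single 1]
  · simp
  · intro n hn
    simp [coeff_X, hn]

/-- Evaluation at a point of the open unit disc, as a ring homomorphism. -/
def ev (z : Disc p) : ℤ_[p]⟦X⟧ →+* 𝓞_ℂ_[p] where
  toFun g := evalInt g z
  map_one' := Subtype.ext <| by
    rw [← map_one C, evalInt_C]; simp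
  map_zero' := Subtype.ext <| by
    rw [← map_zero C, evalInt_C]; simp
  map_add' g h := Subtype.ext <| by
    push_cast
    simp only [coe_evalInt]
    rw [← (summable_evalInt g z.2).of_norm.tsum_add (summable_evalInt h z.2).of_norm]
    refine tsum_congr fun n => ?_
    rw [map_add, map_add, add_mul]
  map_mul' g h := Subtype.ext <| by
    push_cast
    simp only [coe_evalInt]
    rw [tsum_mul_tsum_eq_tsum_sum_antidiagonal_of_summable_norm (summable_evalInt g z.2)
      (summable_evalInt h z.2)]
    refine tsum_congr fun n => ?_
    rw [coeff_mul, map_sum, Finset.sum_mul]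
    refine Finset.sum_congr rfl fun kl hkl => ?_
    rw [← Finset.HasAntidiagonal.mem_antidiagonal.1 hkl, pow_add, map_mul]
    ring

theorem ev_C (z : Disc p) (a : ℤ_[p]) : (ev z (C a) : ℂ_[p]) = toCp p a :=
  evalInt_C a z

theorem ev_X (z : Disc p) : ev z X = z := evalInt_X _

theorem norm_ev_C (z : Disc p) (a : ℤ_[p]) : ‖(ev z (C a) : ℂ_[p])‖ = ‖a‖ := by
  rw [ev_C, norm_toCp]

/-- Ring homomorphisms to `𝓞_{ℂ_p}` with the same restriction to `ℤ_p` which map `X` to the same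
point of the open disc agree. -/
theorem ringHom_ext_of_norm_lt_one {θ θ' : ℤ_[p]⟦X⟧ →+* 𝓞_ℂ_[p]}
    (hC : ∀ a, (θ (C a) : ℂ_[p]) = θ' (C a)) (hX : θ X = θ' X) (h1 : ‖(θ X : ℂ_[p])‖ < 1) :
    θ = θ' :=
  powerSeries_ringHom_ext (fun a => Subtype.ext (hC a)) hX
    fun _ hr => eq_zero_of_forall_pow_dvd h1 hr

theorem norm_ev_le {z : Disc p} {g : ℤ_[p]⟦X⟧} (hg : constantCoeff g = 0) :
    ‖(ev z g : ℂ_[p])‖ ≤ ‖(z.1 : ℂ_[p])‖ := by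
  obtain ⟨h, rfl⟩ := X_dvd_iff.2 hg
  rw [← integers_dvd_iff, map_mul, ev_X]
  exact dvd_mul_right _ _

theorem subst_C_eq {g : ℤ_[p]⟦X⟧} (a : ℤ_[p]) : (C a).subst g = C a :=
  subst_C (S := ℤ_[p]) (a := g) a

/-- `S₀(ℤ_p)` acts on the open unit disc. -/
instance : MulAction (S0 ℤ_[p]) (Disc p) where
  smul g z := ⟨ev z g.series, (norm_ev_le g.constantCoeff_series).trans_lt z.2⟩
  one_smul z := Subtype.ext (ev_X z)
  mul_smul g h z := by
    refine Subtype.ext ?_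
    set w : Disc p := ⟨ev z h.series, (norm_ev_le h.constantCoeff_series).trans_lt z.2⟩ with hw
    change ev z (g.series.subst h.series) = ev w g.series
    rw [← S0.substHom_apply]
    have : (ev z).comp h.substHom = ev w := by
      apply ringHom_ext_of_norm_lt_one
      · intro a
        rw [RingHom.comp_apply, S0.substHom_apply, subst_C_eq, ev_C, ev_C]
      · rw [RingHom.comp_apply, S0.substHom_apply, subst_X h.hasSubst, ev_X]
      · rw [RingHom.comp_apply, S0.substHom_apply, subst_X h.hasSubst]
        exact w.2
    exact congrArg (fun φ => φ g.series) this

theorem smul_val (g : S0 ℤ_[p]) (z : Disc p) : (g • z).1 = ev z g.series := rfl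

theorem ev_subst (g : ℤ_[p]⟦X⟧) (h : S0 ℤ_[p]) (z : Disc p) :
    ev z (g.subst h.series) = ev (h • z) g := by
  rw [← S0.substHom_apply]
  have : (ev z).comp h.substHom = ev (h • z) := by
    apply ringHom_ext_of_norm_lt_one
    · intro a
      rw [RingHom.comp_apply, S0.substHom_apply, subst_C_eq, ev_C, ev_C]
    · rw [RingHom.comp_apply, S0.substHom_apply, subst_X h.hasSubst, ev_X]
      rfl
    · rw [RingHom.comp_apply, S0.substHom_apply, subst_X h.hasSubst]
      exact (h • z).2
  exact congrArg (fun φ => φ g) this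

/-- The point `0` of the open disc. -/
instance : Zero (Disc p) := ⟨⟨0, by simp⟩⟩

theorem Disc.val_zero : (0 : Disc p).1 = 0 := rfl

theorem ev_zero (g : ℤ_[p]⟦X⟧) : ev (0 : Disc p) g = ev 0 (C (constantCoeff g)) := by
  obtain ⟨h, hh⟩ : X ∣ g - C (constantCoeff g) := X_dvd_iff.2 (by simp)
  rw [← sub_eq_zero, ← map_sub, hh, map_mul, ev_X, Disc.val_zero, zero_mul]

theorem smul_zero' (g : S0 ℤ_[p]) : g • (0 : Disc p) = 0 := by
  refine Subtype.ext ?_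
  rw [smul_val, ev_zero, g.constantCoeff_series, map_zero, map_zero, Disc.val_zero]

/-! ### The Galois action on the open unit disc -/

theorem galC_algebraMap (σ : Gal(PadicAlgCl p/ℚ_[p])) (a : ℚ_[p]) :
    galC σ (algebraMap ℚ_[p] ℂ_[p] a) = algebraMap ℚ_[p] ℂ_[p] a := by
  rw [IsScalarTower.algebraMap_apply ℚ_[p] (PadicAlgCl p) ℂ_[p]]
  refine (UniformSpace.Completion.mapRingHom_coe (isometry_gal σ).continuous _).trans ?_
  exact congrArg _ (σ.commutes a)

theorem galC_coe (σ : Gal(PadicAlgCl p/ℚ_[p])) (a : PadicAlgCl p) :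
    galC σ (a : ℂ_[p]) = ((σ a : PadicAlgCl p) : ℂ_[p]) :=
  UniformSpace.Completion.mapRingHom_coe (isometry_gal σ).continuous a

theorem coe_galInt (σ : Gal(PadicAlgCl p/ℚ_[p])) (z : 𝓞_ℂ_[p]) :
    (galInt σ z : ℂ_[p]) = galC σ z := rfl

theorem galInt_injective (σ : Gal(PadicAlgCl p/ℚ_[p])) : Function.Injective (galInt σ) :=
  fun _ _ h => Subtype.ext ((galC σ).injective (congrArg Subtype.val h))

/-- The Galois action on the open unit disc. -/
def galD (σ : Gal(PadicAlgCl p/ℚ_[p])) (z : Disc p) : Disc p :=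
  ⟨galInt σ z.1, by rw [coe_galInt, norm_galC]; exact z.2⟩

theorem galD_injective (σ : Gal(PadicAlgCl p/ℚ_[p])) : Function.Injective (galD σ) :=
  fun _ _ h => Subtype.ext (galInt_injective σ (congrArg Subtype.val h))

/-- Power series over `ℤ_p` are Galois equivariant. -/
theorem ev_galD (σ : Gal(PadicAlgCl p/ℚ_[p])) (z : Disc p) (g : ℤ_[p]⟦X⟧) :
    ev (galD σ z) g = galInt σ (ev z g) := by
  have : ev (galD σ z) = (galInt σ).comp (ev z) := by
    apply ringHom_ext_of_norm_lt_one
    · intro a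
      rw [RingHom.comp_apply, coe_galInt, ev_C, ev_C]
      exact (galC_algebraMap σ _).symm
    · rw [RingHom.comp_apply, ev_X, ev_X]; rfl
    · rw [ev_X]; exact (galD σ z).2
  exact congrArg (fun φ => φ g) this

theorem galD_smul (σ : Gal(PadicAlgCl p/ℚ_[p])) (g : S0 ℤ_[p]) (z : Disc p) :
    galD σ (g • z) = g • galD σ z :=
  Subtype.ext (ev_galD σ z g.series).symm

/-! ### Zeros of power series over `ℤ_p` in the open unit disc -/

/-- Reduction of power series modulo `p`. -/
abbrev red : ℤ_[p]⟦X⟧ →+* (IsLocalRing.ResidueField ℤ_[p])⟦X⟧ :=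
  PowerSeries.map (IsLocalRing.residue ℤ_[p])

theorem mem_maximalIdeal_iff (a : ℤ_[p]) :
    a ∈ IsLocalRing.maximalIdeal ℤ_[p] ↔ ‖a‖ < 1 := by
  rw [PadicInt.maximalIdeal_eq_span_p, Ideal.mem_span_singleton, PadicInt.norm_lt_one_iff_dvd]

theorem norm_le_inv_of_norm_lt_one {a : ℤ_[p]} (h : ‖a‖ < 1) : ‖a‖ ≤ (p : ℝ)⁻¹ := by
  obtain ⟨b, rfl⟩ := (PadicInt.norm_lt_one_iff_dvd a).1 h
  rw [norm_mul, PadicInt.norm_p]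
  exact mul_le_of_le_one_right prime_inv_pos.le (PadicInt.norm_le_one b)

theorem isUnit_iff_norm_constantCoeff {g : ℤ_[p]⟦X⟧} : IsUnit g ↔ ‖constantCoeff g‖ = 1 := by
  rw [isUnit_iff_constantCoeff, PadicInt.isUnit_iff]

theorem ev_ne_zero_of_isUnit {g : ℤ_[p]⟦X⟧} (hg : IsUnit g) (z : Disc p) : ev z g ≠ 0 :=
  (hg.map (ev z)).ne_zero

theorem red_eq_zero_iff (g : ℤ_[p]⟦X⟧) : red g = 0 ↔ C (p : ℤ_[p]) ∣ g := by
  constructor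
  · intro h
    have h' : ∀ n, ∃ b, coeff n g = p * b := by
      intro n
      have := congrArg (coeff n) h
      rw [coeff_map, map_zero, IsLocalRing.residue_eq_zero_iff, mem_maximalIdeal_iff,
        PadicInt.norm_lt_one_iff_dvd] at this
      exact this
    choose b hb using h'
    exact ⟨mk b, PowerSeries.ext fun n => by rw [coeff_C_mul, coeff_mk, hb]⟩
  · rintro ⟨h, rfl⟩
    rw [map_mul, map_C, (IsLocalRing.residue_eq_zero_iff _).2, map_zero, zero_mul]
    rw [mem_maximalIdeal_iff, PadicInt.norm_p]
    exact prime_inv_lt_one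

/-- The value at a point of a polynomial over `ℤ_p` viewed as a power series. -/
theorem coe_ev_polynomial (z : Disc p) (Q : Polynomial ℤ_[p]) :
    (ev z (Q : ℤ_[p]⟦X⟧) : ℂ_[p]) =
      Polynomial.aeval (z.1 : ℂ_[p]) (Q.map (algebraMap ℤ_[p] ℚ_[p])) := by
  have : (PadicComplexInt p).subtype.comp ((ev z).comp Polynomial.coeToPowerSeries.ringHom) =
      (Polynomial.aeval (R := ℚ_[p]) (z.1 : ℂ_[p])).toRingHom.comp
        (Polynomial.mapRingHom (algebraMap ℤ_[p] ℚ_[p])) := by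
    apply Polynomial.ringHom_ext
    · intro a
      simp only [RingHom.comp_apply, Polynomial.coeToPowerSeries.ringHom_apply, Polynomial.coe_C]
      refine (ev_C z a).trans ?_
      simp [toCp]
      rfl
    · simp [ev_X]
  exact congrArg (fun φ => φ Q) this

theorem norm_lt_one_of_isDistinguished {Q : Polynomial ℤ_[p]}
    (hQ : Q.IsDistinguishedAt (IsLocalRing.maximalIdeal ℤ_[p])) {y : ℂ_[p]}
    (hy : Polynomial.aeval y (Q.map (algebraMap ℤ_[p] ℚ_[p])) = 0) : ‖y‖ < 1 := by
  by_contra! h1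
  have hpos : 0 < ‖y‖ := one_pos.trans_le h1
  rw [Polynomial.aeval_def, Polynomial.eval₂_map, Polynomial.eval₂_eq_sum_range,
    Finset.sum_range_succ, hQ.monic.coeff_natDegree, map_one, one_mul, add_comm,
    add_eq_zero_iff_eq_neg] at hy
  have h2 : ‖y ^ Q.natDegree‖ ≤ (p : ℝ)⁻¹ * ‖y‖ ^ Q.natDegree := by
    rw [hy, norm_neg]
    refine IsUltrametricDist.norm_sum_le_of_forall_le_of_nonneg (by positivity) fun i hi => ?_
    have hi := Finset.mem_range.1 hi
    rw [norm_mul, norm_pow]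
    gcongr
    · have := norm_toCp (Q.coeff i)
      refine this.le.trans (norm_le_inv_of_norm_lt_one ?_)
      exact (mem_maximalIdeal_iff _).1 (hQ.mem hi)
  rw [norm_pow] at h2
  have : (p : ℝ)⁻¹ * ‖y‖ ^ Q.natDegree < 1 * ‖y‖ ^ Q.natDegree :=
    mul_lt_mul_of_pos_right prime_inv_lt_one (by positivity)
  linarith

theorem exists_coe_of_aeval_eq_zero {P : Polynomial ℚ_[p]} (hP : P ≠ 0) {z : ℂ_[p]}
    (hz : Polynomial.aeval z P = 0) : ∃ y : PadicAlgCl p, (y : ℂ_[p]) = z := by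
  have hs : (P.map (algebraMap ℚ_[p] (PadicAlgCl p))).Splits := IsAlgClosed.splits _
  have h := hs.roots_map (algebraMap (PadicAlgCl p) ℂ_[p])
  have hz' : z ∈ ((P.map (algebraMap ℚ_[p] (PadicAlgCl p))).map
      (algebraMap (PadicAlgCl p) ℂ_[p])).roots := by
    rw [Polynomial.map_map, ← IsScalarTower.algebraMap_eq, Polynomial.mem_roots',
      Polynomial.IsRoot.def, Polynomial.eval_map_algebraMap]
    exact ⟨(Polynomial.map_ne_zero_iff (algebraMap ℚ_[p] ℂ_[p]).injective).2 hP, hz⟩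
  rw [h, Multiset.mem_map] at hz'
  obtain ⟨y, -, hy⟩ := hz'
  exact ⟨y, hy⟩

theorem ev_eq_zero_iff {g U : ℤ_[p]⟦X⟧} {Q : Polynomial ℤ_[p]}
    (H : g.IsWeierstrassFactorization Q U) (z : Disc p) :
    ev z g = 0 ↔ Polynomial.aeval (z.1 : ℂ_[p]) (Q.map (algebraMap ℤ_[p] ℚ_[p])) = 0 := by
  rw [← coe_ev_polynomial, H.eq_mul, map_mul, mul_eq_zero,
    or_iff_left (ev_ne_zero_of_isUnit H.isUnit z), ZeroMemClass.coe_eq_zero]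

/-- A nonzero power series over `ℤ_p` is a power of `p` times a series which is nonzero mod `p`. -/
theorem exists_eq_pow_mul_red_ne_zero {g : ℤ_[p]⟦X⟧} (hg : g ≠ 0) :
    ∃ (s : ℕ) (h : ℤ_[p]⟦X⟧), g = C (p : ℤ_[p]) ^ s * h ∧ red h ≠ 0 := by
  obtain ⟨n, hn⟩ : ∃ n, coeff n g ≠ 0 := by
    by_contra! h
    exact hg (PowerSeries.ext h)
  by_contra! hcon
  have hall : ∀ s, ∃ h, g = C (p : ℤ_[p]) ^ s * h := by
    intro s
    induction s with
    | zero => exact ⟨g, by simp⟩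
    | succ s ih =>
      obtain ⟨h, hh⟩ := ih
      obtain ⟨h', rfl⟩ := (red_eq_zero_iff h).1 (hcon s h hh)
      exact ⟨h', by rw [hh, pow_succ, mul_assoc]⟩
  obtain ⟨h, hh⟩ := hall ((coeff n g).valuation + 1)
  have h1 : (p : ℤ_[p]) ^ ((coeff n g).valuation + 1) ∣ coeff n g :=
    ⟨coeff n h, by conv_lhs => rw [hh, ← map_pow, coeff_C_mul]⟩
  rw [← Ideal.mem_span_singleton, PadicInt.mem_span_pow_iff_le_valuation _ hn] at h1
  omega

/-- A nonzero power series over `ℤ_p` has finitely many zeros in the open unit disc. -/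
theorem finite_zeros {g : ℤ_[p]⟦X⟧} (hg : g ≠ 0) : {z : Disc p | ev z g = 0}.Finite := by
  obtain ⟨s, h, rfl, hh⟩ := exists_eq_pow_mul_red_ne_zero hg
  obtain ⟨Q, U, H⟩ := exists_isWeierstrassFactorization hh
  have hQ : Q.map (algebraMap ℤ_[p] ℚ_[p]) ≠ 0 := (H.isDistinguishedAt.monic.map _).ne_zero
  refine Set.Finite.of_finite_image (f := fun z : Disc p => (z.1 : ℂ_[p])) ?_
    fun z _ w _ hzw => Subtype.ext (Subtype.ext hzw)
  refine ((Q.map (algebraMap ℤ_[p] ℚ_[p])).rootSet_finite ℂ_[p]).subset ?_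
  rintro _ ⟨z, hz, rfl⟩
  rw [Polynomial.mem_rootSet]
  refine ⟨hQ, (ev_eq_zero_iff H z).1 ?_⟩
  have hz : ev z (C (p : ℤ_[p]) ^ s * h) = 0 := hz
  rw [map_mul, map_pow] at hz
  refine (mul_eq_zero.1 hz).resolve_left (pow_ne_zero _ fun h0 => ?_)
  have := norm_ev_C z (p : ℤ_[p])
  rw [h0, PadicInt.norm_p] at this
  simp at this
  exact (Fact.out : p.Prime).ne_zero (by exact_mod_cast this.symm)

/-! ### Eisenstein series -/

/-- A power series over `ℤ_p` whose constant term is a uniformizer and which does not vanish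
modulo `p`. By Weierstrass preparation it is a unit times an Eisenstein polynomial. -/
structure IsEisensteinSeries (g : ℤ_[p]⟦X⟧) : Prop where
  norm_constantCoeff : ‖constantCoeff g‖ = (p : ℝ)⁻¹
  red_ne_zero : red g ≠ 0

namespace IsEisensteinSeries

variable {g : ℤ_[p]⟦X⟧} (hg : IsEisensteinSeries g)
include hg

theorem irreducible {U : ℤ_[p]⟦X⟧} {Q : Polynomial ℤ_[p]}
    (H : g.IsWeierstrassFactorization Q U) :
    Irreducible (Q.map (algebraMap ℤ_[p] ℚ_[p])) := by
  have hU : ‖constantCoeff U‖ = 1 := isUnit_iff_norm_constantCoeff.1 H.isUnit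
  have h0 : ‖Q.coeff 0‖ = (p : ℝ)⁻¹ := by
    rw [← hg.norm_constantCoeff, H.eq_mul, map_mul, norm_mul, hU, mul_one,
      Polynomial.constantCoeff_coe]
  rw [← H.isDistinguishedAt.monic.irreducible_iff_irreducible_map_fraction_map]
  refine Polynomial.IsEisensteinAt.irreducible (𝓟 := IsLocalRing.maximalIdeal ℤ_[p])
    ⟨?_, fun hn => H.isDistinguishedAt.mem hn, ?_⟩ inferInstance
    H.isDistinguishedAt.monic.isPrimitive ?_
  · exact H.isDistinguishedAt.monic.leadingCoeff_notMem (Ideal.IsPrime.ne_top inferInstance)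
  · rw [PadicInt.maximalIdeal_eq_span_p, Ideal.span_singleton_pow, Ideal.mem_span_singleton]
    rintro ⟨b, hb⟩
    rw [hb, norm_mul, norm_pow, PadicInt.norm_p] at h0
    have h1 := PadicInt.norm_le_one b
    have h2 := prime_inv_lt_one (p := p)
    have h3 := prime_inv_pos (p := p)
    nlinarith
  · rw [Nat.pos_iff_ne_zero]
    intro hd
    rw [H.isDistinguishedAt.monic.natDegree_eq_zero.1 hd] at h0
    simp at h0
    exact prime_inv_lt_one.ne' (by simpa using h0)

theorem eq_minpoly {U : ℤ_[p]⟦X⟧} {Q : Polynomial ℤ_[p]}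
    (H : g.IsWeierstrassFactorization Q U) {z : Disc p} (hz : ev z g = 0) :
    Q.map (algebraMap ℤ_[p] ℚ_[p]) = minpoly ℚ_[p] (z.1 : ℂ_[p]) :=
  minpoly.eq_of_irreducible_of_monic (hg.irreducible H) ((ev_eq_zero_iff H z).1 hz)
    (H.isDistinguishedAt.monic.map _)

/-- An Eisenstein series divides every series which vanishes at one of its zeros. -/
theorem dvd {z : Disc p} (hz : ev z g = 0) {h : ℤ_[p]⟦X⟧} (hh : ev z h = 0) : g ∣ h := by
  obtain ⟨Q, U, H⟩ := exists_isWeierstrassFactorization hg.red_ne_zero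
  have hdiv := h.isWeierstrassDivision_weierstrassDiv_weierstrassMod hg.red_ne_zero
  set r := h.weierstrassMod g
  have hr : Polynomial.aeval (z.1 : ℂ_[p]) (r.map (algebraMap ℤ_[p] ℚ_[p])) = 0 := by
    rw [hdiv.eq_mul_add, map_add, map_mul, hz, zero_mul, zero_add] at hh
    rw [← coe_ev_polynomial, hh]
    rfl
  have hdeg : (r.map (algebraMap ℤ_[p] ℚ_[p])).degree <
      (Q.map (algebraMap ℤ_[p] ℚ_[p])).degree := by
    rw [H.isDistinguishedAt.monic.degree_map, Polynomial.degree_eq_natDegree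
      H.isDistinguishedAt.monic.ne_zero, H.natDegree_eq_toNat_order_map]
    exact Polynomial.degree_map_le.trans_lt hdiv.degree_lt
  have h0 := Polynomial.eq_zero_of_dvd_of_degree_lt (minpoly.dvd ℚ_[p] _ hr)
    (hg.eq_minpoly H hz ▸ hdeg)
  rw [Polynomial.map_eq_zero_iff (IsFractionRing.injective ℤ_[p] ℚ_[p])] at h0
  exact ⟨_, by rw [hdiv.eq_mul_add, h0, Polynomial.coe_zero, add_zero]⟩

theorem ev_derivative_ne_zero {z : Disc p} (hz : ev z g = 0) : ev z (derivative ℤ_[p] g) ≠ 0 := by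
  obtain ⟨Q, U, H⟩ := exists_isWeierstrassFactorization hg.red_ne_zero
  have hz' := (ev_eq_zero_iff H z).1 hz
  have hQ0 : ev z (Q : ℤ_[p]⟦X⟧) = 0 := Subtype.ext ((coe_ev_polynomial z Q).trans hz')
  rw [H.eq_mul, Derivation.leibniz, smul_eq_mul, smul_eq_mul, map_add, map_mul, hQ0, zero_mul,
    zero_add, map_mul, derivative_coe]
  refine mul_ne_zero (ev_ne_zero_of_isUnit H.isUnit z) fun h0 => ?_
  have h1 := congrArg Subtype.val h0
  rw [coe_ev_polynomial, ← Polynomial.derivative_map] at h1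
  exact (hg.irreducible H).separable.aeval_derivative_ne_zero hz' h1

/-- The Galois group permutes the zeros of an Eisenstein series transitively. -/
theorem exists_galD_eq {z w : Disc p} (hz : ev z g = 0) (hw : ev w g = 0) :
    ∃ σ : Gal(PadicAlgCl p/ℚ_[p]), galD σ z = w := by
  obtain ⟨Q, U, H⟩ := exists_isWeierstrassFactorization hg.red_ne_zero
  have hirr := hg.irreducible H
  have key : ∀ v : Disc p, ev v g = 0 → ∃ y : PadicAlgCl p, (y : ℂ_[p]) = v.1 ∧
      Q.map (algebraMap ℤ_[p] ℚ_[p]) = minpoly ℚ_[p] y := by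
    intro v hv
    obtain ⟨y, hy⟩ := exists_coe_of_aeval_eq_zero hirr.ne_zero ((ev_eq_zero_iff H v).1 hv)
    refine ⟨y, hy, ?_⟩
    rw [hg.eq_minpoly H hv, ← hy]
    exact minpoly.algebraMap_eq (algebraMap (PadicAlgCl p) ℂ_[p]).injective y
  obtain ⟨y, hy, hym⟩ := key z hz
  obtain ⟨x, hx, hxm⟩ := key w hw
  obtain ⟨σ, hσ⟩ := IsConjRoot.exists_algEquiv (K := ℚ_[p]) (x := x) (y := y)
    (hxm.symm.trans hym)
  refine ⟨σ, Subtype.ext (Subtype.ext ?_)⟩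
  change galC σ (z.1 : ℂ_[p]) = w.1
  rw [← hy, ← hx, galC_coe, hσ]

/-- The number of zeros is the order of vanishing modulo `p`. -/
theorem ncard_zeros : {z : Disc p | ev z g = 0}.ncard = (red g).order.toNat := by
  obtain ⟨Q, U, H⟩ := exists_isWeierstrassFactorization hg.red_ne_zero
  rw [← H.natDegree_eq_toNat_order_map, ← H.isDistinguishedAt.monic.natDegree_map
    (algebraMap ℤ_[p] ℚ_[p]), ← Polynomial.card_rootSet_eq_natDegree (K := ℂ_[p])
    (hg.irreducible H).separable (IsAlgClosed.splits _), ← Nat.card_eq_fintype_card,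
    Nat.card_coe_set_eq, ← Set.ncard_image_of_injective (f := fun z : Disc p => (z.1 : ℂ_[p])) _
      (Subtype.val_injective.comp Subtype.val_injective)]
  congr 1
  ext y
  rw [Polynomial.mem_rootSet, and_iff_right (hg.irreducible H).ne_zero]
  constructor
  · rintro ⟨z, hz, rfl⟩
    exact (ev_eq_zero_iff H z).1 hz
  · intro hy
    have h1 := norm_lt_one_of_isDistinguished H.isDistinguishedAt hy
    exact ⟨⟨⟨y, (mem_integers_iff p y).2 h1.le⟩, h1⟩, (ev_eq_zero_iff H _).2 hy, rfl⟩

theorem exists_zero : ∃ z : Disc p, ev z g = 0 := by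
  obtain ⟨Q, U, H⟩ := exists_isWeierstrassFactorization hg.red_ne_zero
  obtain ⟨y, hy⟩ := IsAlgClosed.exists_aeval_eq_zero ℂ_[p] _
    (Polynomial.degree_pos_of_irreducible (hg.irreducible H)).ne'
  have h1 := norm_lt_one_of_isDistinguished H.isDistinguishedAt hy
  exact ⟨⟨⟨y, (mem_integers_iff p y).2 h1.le⟩, h1⟩, (ev_eq_zero_iff H _).2 hy⟩

end IsEisensteinSeries

end HeightOne

namespace HeightOne

open PowerSeries

/-! ### Composition of power series -/

namespace S0

variable {R : Type*} [CommRing R]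

theorem subst_C (h : S0 R) (a : R) : (C a).subst h.series = C a :=
  PowerSeries.subst_C (S := R) (a := h.series) a

theorem substHom_C (h : S0 R) (a : R) : h.substHom (C a) = C a := by
  rw [substHom_apply, subst_C]

theorem substHom_X (h : S0 R) : h.substHom X = h.series := by
  rw [substHom_apply, subst_X h.hasSubst]

theorem constantCoeff_substHom (h : S0 R) (g : R⟦X⟧) :
    constantCoeff (h.substHom g) = constantCoeff g := by
  obtain ⟨k, hk⟩ : X ∣ g - C (constantCoeff g) := X_dvd_iff.2 (by simp)
  have h1 := congrArg (fun t => constantCoeff (h.substHom t)) hk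
  simp only [map_sub, substHom_C, map_mul, substHom_X, h.constantCoeff_series, zero_mul,
    constantCoeff_C] at h1
  exact sub_eq_zero.1 h1

/-- The quotient `h(x)/x`. -/
def divX (h : S0 R) : R⟦X⟧ := PowerSeries.mk fun n => coeff (n + 1) h.series

theorem series_eq_X_mul_divX (h : S0 R) : h.series = X * h.divX := by
  ext n
  cases n with
  | zero => simp [h.constantCoeff_series]
  | succ n => rw [coeff_succ_X_mul, divX, coeff_mk]

theorem constantCoeff_divX (h : S0 R) : constantCoeff h.divX = h.linearCoeff := by
  rw [← coeff_zero_eq_constantCoeff_apply, divX, coeff_mk]; rfl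

theorem linearCoeff_one : (1 : S0 R).linearCoeff = 1 := coeff_one_X

theorem linearCoeff_mul (g h : S0 R) : (g * h).linearCoeff = g.linearCoeff * h.linearCoeff := by
  have : (g * h).series = X * (h.divX * h.substHom g.divX) := by
    rw [mul_series, ← substHom_apply, g.series_eq_X_mul_divX, map_mul, substHom_X,
      h.series_eq_X_mul_divX, mul_assoc]
  rw [linearCoeff, this, coeff_succ_X_mul, coeff_zero_eq_constantCoeff_apply, map_mul,
    constantCoeff_substHom, constantCoeff_divX, constantCoeff_divX, mul_comm]

theorem linearCoeff_pow (g : S0 R) (n : ℕ) : (g ^ n).linearCoeff = g.linearCoeff ^ n := by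
  induction n with
  | zero => rw [pow_zero, pow_zero, linearCoeff_one]
  | succ n ih => rw [pow_succ, pow_succ, linearCoeff_mul, ih]

/-- The linear coefficient of a series is the constant term of its derivative. -/
theorem constantCoeff_derivative (h : S0 R) :
    constantCoeff (derivative R h.series) = h.linearCoeff := by
  rw [← coeff_zero_eq_constantCoeff_apply, coeff_derivative]
  simp [linearCoeff]

/-- The chain rule. -/
theorem derivative_mul (g h : S0 R) : derivative R (g * h).series =
    h.substHom (derivative R g.series) * derivative R h.series := by
  rw [mul_series, derivative_subst h.hasSubst, substHom_apply]

/-- Reduction of coefficients along a ring homomorphism. -/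
def map {S : Type*} [CommRing S] (φ : R →+* S) : S0 R →* S0 S where
  toFun g := ⟨PowerSeries.map φ g.series, by
    rw [← coeff_zero_eq_constantCoeff_apply, coeff_map, coeff_zero_eq_constantCoeff_apply,
      g.constantCoeff_series, map_zero]⟩
  map_one' := ext' (PowerSeries.map_X φ)
  map_mul' g h := ext' (PowerSeries.map_subst h.hasSubst g.series)

theorem map_series {S : Type*} [CommRing S] (φ : R →+* S) (g : S0 R) :
    (map φ g).series = PowerSeries.map φ g.series := rfl

theorem map_substHom {S : Type*} [CommRing S] (φ : R →+* S) (h : S0 R) (g : R⟦X⟧) :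
    PowerSeries.map φ (h.substHom g) = (map φ h).substHom (PowerSeries.map φ g) := by
  rw [substHom_apply, substHom_apply]
  exact PowerSeries.map_subst h.hasSubst g

/-- The order of a composite is the product of the orders. -/
theorem order_substHom {k : Type*} [Field k] (h : S0 k) {g : k⟦X⟧} (hg : g ≠ 0) :
    (h.substHom g).order = g.order.toNat • h.series.order := by
  have h3 : (h.substHom g.divXPowOrder).order = 0 := by
    by_contra h0
    have := order_ne_zero_iff_constCoeff_eq_zero.1 h0
    rw [constantCoeff_substHom] at this
    exact hg (constantCoeff_divXPowOrder_eq_zero_iff.1 this)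
  conv_lhs => rw [← X_pow_order_mul_divXPowOrder (f := g)]
  rw [map_mul, map_pow, substHom_X, order_mul, order_pow, h3, add_zero]

end S0

variable {p : ℕ} [Fact p.Prime]

/-- Composition with a fixed series respects congruences modulo an ideal. -/
theorem substHom_sub_substHom_mem {R : Type*} [CommRing R] [IsNoetherianRing R]
    (I : Ideal R⟦X⟧) {v w : S0 R} (h : v.series - w.series ∈ I) (g : R⟦X⟧) :
    v.substHom g - w.substHom g ∈ I := by
  rw [← Ideal.Quotient.mk_eq_mk_iff_sub_mem] at h ⊢
  have : (Ideal.Quotient.mk I).comp v.substHom = (Ideal.Quotient.mk I).comp w.substHom := by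
    apply powerSeries_ringHom_ext
    · intro a
      simp only [RingHom.comp_apply, S0.substHom_C]
    · simpa only [RingHom.comp_apply, S0.substHom_X] using h
    · intro r hr
      have hX : Ideal.span {(X : R⟦X⟧)} ≤ Ideal.jacobson ⊥ := by
        rw [Ideal.span_singleton_le_iff_mem, Ideal.mem_jacobson_bot]
        intro y
        rw [isUnit_iff_constantCoeff, map_add, map_mul, constantCoeff_X, zero_mul, zero_add,
          map_one]
        exact isUnit_one
      refine (IsHausdorff.of_le_jacobson (Ideal.span {(X : R⟦X⟧)}) (R⟦X⟧ ⧸ I) hX).haus r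
        fun N => ?_
      rw [SModEq.zero]
      obtain ⟨t, rfl⟩ := hr N
      rw [RingHom.comp_apply, S0.substHom_X, v.series_eq_X_mul_divX, ← map_pow, mul_pow,
        map_mul, mul_assoc]
      change (X : R⟦X⟧) ^ N • (Ideal.Quotient.mk I (v.divX ^ N) * t) ∈ _
      exact Submodule.smul_mem_smul (Ideal.pow_mem_pow (Ideal.mem_span_singleton_self _) N)
        Submodule.mem_top
  exact congrArg (fun φ => φ g) this

/-- `w^{∘m}(x) - x` is divisible by `w(x) - x`. -/
theorem series_sub_X_dvd_pow {R : Type*} [CommRing R] [IsNoetherianRing R] (w : S0 R) (m : ℕ) :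
    w.series - X ∣ (w ^ m).series - X := by
  induction m with
  | zero => rw [pow_zero, S0.one_series, sub_self]; exact dvd_zero _
  | succ m ih =>
    have h1 := substHom_sub_substHom_mem (Ideal.span {w.series - X}) (v := w) (w := 1)
      (Ideal.mem_span_singleton_self _) (w ^ m).series
    rw [Ideal.mem_span_singleton, S0.substHom_one, S0.substHom_apply, ← S0.mul_series,
      ← pow_succ] at h1
    simpa using dvd_add h1 ih

/-- Rigidity: a series commuting with `f` is determined by its linear coefficient, when `f'(0)` is
neither `0` nor a root of unity. -/
theorem eq_of_commute_of_linearCoeff_eq {R : Type*} [CommRing R] [IsNoetherianRing R] [IsDomain R]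
    {f v w : S0 R} (hf : ∀ d, 2 ≤ d → f.linearCoeff ^ d ≠ f.linearCoeff)
    (hv : f * v = v * f) (hw : f * w = w * f) (h : v.linearCoeff = w.linearCoeff) : v = w := by
  by_contra hne
  have hne' : v.series - w.series ≠ 0 := fun h0 => hne (S0.ext' (sub_eq_zero.1 h0))
  obtain ⟨d, hd, r, hr, hr0⟩ : ∃ d, 2 ≤ d ∧ ∃ r, v.series - w.series = X ^ d * r ∧
      constantCoeff r ≠ 0 := by
    have hc0 := coeff_order hne'
    refine ⟨_, ?_, _, X_pow_order_mul_divXPowOrder.symm,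
      fun h0 => hne' (constantCoeff_divXPowOrder_eq_zero_iff.1 h0)⟩
    by_contra! hlt
    interval_cases hn : (v.series - w.series).order.toNat
    · simp [v.constantCoeff_series, w.constantCoeff_series] at hc0
    · rw [map_sub] at hc0
      exact hc0 (sub_eq_zero.2 h)
  set I : Ideal R⟦X⟧ := Ideal.span {X ^ (d + 1)} with hI
  have hXd : ∀ t, X * (v.series - w.series) * t ∈ I := fun t => by
    rw [hI, Ideal.mem_span_singleton, hr]
    exact ⟨r * t, by ring⟩
  -- modulo `x ^ (d + 1)`, the difference `f(v) - f(w)` is `f'(0) (v - w)`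
  obtain ⟨g, hg⟩ : ∃ g, f.divX = C f.linearCoeff + X * g := by
    obtain ⟨g, hg⟩ : X ∣ f.divX - C f.linearCoeff :=
      X_dvd_iff.2 (by simp [S0.constantCoeff_divX])
    exact ⟨g, by rw [← hg]; ring⟩
  have hfv : ∀ v : S0 R, (f * v).series =
      C f.linearCoeff * v.series + v.series ^ 2 * v.substHom g := by
    intro v
    rw [S0.mul_series, ← S0.substHom_apply, f.series_eq_X_mul_divX, hg, map_mul, map_add, map_mul,
      S0.substHom_X, S0.substHom_C]
    ring
  have h1 : (f * v).series - (f * w).series - C f.linearCoeff * (v.series - w.series) ∈ I := by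
    have h2 : v.substHom g - w.substHom g ∈ Ideal.span {v.series - w.series} :=
      substHom_sub_substHom_mem _ (Ideal.mem_span_singleton_self _) g
    obtain ⟨t, ht⟩ := Ideal.mem_span_singleton.1 h2
    have : (f * v).series - (f * w).series - C f.linearCoeff * (v.series - w.series) =
        X * (v.series - w.series) * ((v.divX + w.divX) * v.substHom g + w.divX * w.series * t) := by
      rw [hfv, hfv]
      have e1 := v.series_eq_X_mul_divX
      have e2 := w.series_eq_X_mul_divX
      linear_combination (v.series - w.series) * v.substHom g * (e1 + e2) +
        (v.series - w.series) * w.series * t * e2 +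
        w.series ^ 2 * ht
    rw [this]
    exact hXd _
  -- while `v(f) - w(f)` is `f'(0) ^ d (v - w)`
  have h2 : (v * f).series - (w * f).series = X ^ d * (f.divX ^ d * f.substHom r) := by
    rw [S0.mul_series, S0.mul_series, ← S0.substHom_apply, ← S0.substHom_apply, ← map_sub, hr,
      map_mul, map_pow, S0.substHom_X, ← mul_assoc, ← mul_pow, ← f.series_eq_X_mul_divX]
  rw [hv, hw, h2, hr, hI, Ideal.mem_span_singleton, X_pow_dvd_iff] at h1
  have h3 := h1 d (Nat.lt_succ_self d)
  rw [show (X : R⟦X⟧) ^ d * (f.divX ^ d * f.substHom r) - C f.linearCoeff * (X ^ d * r) =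
    X ^ d * (f.divX ^ d * f.substHom r - C f.linearCoeff * r) by ring] at h3
  have h4 := coeff_X_pow_mul (f.divX ^ d * f.substHom r - C f.linearCoeff * r) d 0
  rw [zero_add, h3, coeff_zero_eq_constantCoeff_apply] at h4
  simp only [map_sub, map_mul, map_pow, S0.constantCoeff_divX, S0.constantCoeff_substHom,
    constantCoeff_C, ← sub_mul] at h4
  exact hf d hd (sub_eq_zero.1 ((mul_eq_zero.1 h4.symm).resolve_right hr0))

/-! ### The roots of the iterates of `f` -/

theorem pow_linearCoeff_ne {f : S0 ℤ_[p]} (hf : IsEisensteinSeries f.divX) (d : ℕ) (hd : 2 ≤ d) :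
    f.linearCoeff ^ d ≠ f.linearCoeff := by
  intro h
  have h1 := hf.norm_constantCoeff
  rw [S0.constantCoeff_divX] at h1
  have h2 := congrArg norm h
  rw [norm_pow, h1] at h2
  have h3 := pow_lt_pow_right_of_lt_one₀ (prime_inv_pos (p := p)) prime_inv_lt_one hd
  rw [pow_one, h2] at h3
  exact lt_irrefl _ h3

theorem eq_of_commute {f v w : S0 ℤ_[p]} (hf : IsEisensteinSeries f.divX)
    (hv : f * v = v * f) (hw : f * w = w * f) (h : v.linearCoeff = w.linearCoeff) : v = w :=
  eq_of_commute_of_linearCoeff_eq (pow_linearCoeff_ne hf) hv hw h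

theorem norm_linearCoeff_unit (u : (S0 ℤ_[p])ˣ) : ‖(u : S0 ℤ_[p]).linearCoeff‖ = 1 := by
  have h : (u : S0 ℤ_[p]).linearCoeff * ((u⁻¹ : (S0 ℤ_[p])ˣ) : S0 ℤ_[p]).linearCoeff = 1 := by
    rw [← S0.linearCoeff_mul, Units.mul_inv, S0.linearCoeff_one]
  exact PadicInt.isUnit_iff.1 (IsUnit.of_mul_eq_one _ h)

theorem ev_substHom (g : ℤ_[p]⟦X⟧) (h : S0 ℤ_[p]) (z : Disc p) :
    ev z (h.substHom g) = ev (h • z) g := by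
  rw [S0.substHom_apply, ev_subst]

theorem val_smul (f : S0 ℤ_[p]) (z : Disc p) : (f • z).1 = z.1 * ev z f.divX := by
  rw [smul_val, f.series_eq_X_mul_divX, map_mul, ev_X]

theorem norm_ev_lt_one {z : Disc p} {g : ℤ_[p]⟦X⟧} (hg : ‖constantCoeff g‖ < 1) :
    ‖(ev z g : ℂ_[p])‖ < 1 := by
  obtain ⟨k, hk⟩ : X ∣ g - C (constantCoeff g) := X_dvd_iff.2 (by simp)
  rw [eq_add_of_sub_eq hk, map_add, map_mul, ev_X]
  push_cast
  refine (IsUltrametricDist.norm_add_le_max _ _).trans_lt (max_lt ?_ ?_)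
  · rw [norm_mul]
    exact mul_lt_one_of_nonneg_of_lt_one_left (norm_nonneg _) z.2 (norm_le_one _)
  · rwa [norm_ev_C]

/-- `f` strictly contracts the open disc. -/
theorem norm_smul_lt {f : S0 ℤ_[p]} (hf : ‖f.linearCoeff‖ < 1) {z : Disc p} (hz : z ≠ 0) :
    ‖((f • z).1 : ℂ_[p])‖ < ‖(z.1 : ℂ_[p])‖ := by
  have h0 : 0 < ‖(z.1 : ℂ_[p])‖ := norm_pos_iff.2 fun h => hz (Subtype.ext (Subtype.ext h))
  rw [val_smul]
  push_cast
  rw [norm_mul]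
  exact mul_lt_of_lt_one_right h0 (norm_ev_lt_one (by rwa [S0.constantCoeff_divX]))

theorem norm_pow_smul_lt {f : S0 ℤ_[p]} (hf : ‖f.linearCoeff‖ < 1) {z : Disc p} (hz : z ≠ 0)
    (n : ℕ) : ‖((f ^ (n + 1) • z).1 : ℂ_[p])‖ < ‖(z.1 : ℂ_[p])‖ := by
  induction n with
  | zero => rw [zero_add, pow_one]; exact norm_smul_lt hf hz
  | succ n ih =>
    rw [pow_succ', mul_smul]
    by_cases h : f ^ (n + 1) • z = 0
    · rw [h, smul_zero']
      rw [Disc.val_zero, ZeroMemClass.coe_zero, norm_zero]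
      exact norm_pos_iff.2 fun h => hz (Subtype.ext (Subtype.ext h))
    · exact (norm_smul_lt hf h).trans ih

/-- The series `f^{∘(n+1)}(x) / f^{∘n}(x)`; its zeros are the points `z` of the open disc such that
`f^{∘(n+1)}(z) = 0` and `f^{∘n}(z) ≠ 0`. -/
def levelSeries (f : S0 ℤ_[p]) (n : ℕ) : ℤ_[p]⟦X⟧ := (f ^ n).substHom f.divX

theorem ev_levelSeries (f : S0 ℤ_[p]) (n : ℕ) (z : Disc p) :
    ev z (levelSeries f n) = ev (f ^ n • z) f.divX := by
  rw [levelSeries, ev_substHom]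

theorem levelSeries_succ (f : S0 ℤ_[p]) (n : ℕ) :
    levelSeries f (n + 1) = f.substHom (levelSeries f n) := by
  rw [levelSeries, pow_succ, S0.substHom_mul, levelSeries]

theorem ev_levelSeries_succ (f : S0 ℤ_[p]) (n : ℕ) (z : Disc p) :
    ev z (levelSeries f (n + 1)) = ev (f • z) (levelSeries f n) := by
  rw [levelSeries_succ, ev_substHom]

theorem pow_succ_series (f : S0 ℤ_[p]) (n : ℕ) :
    (f ^ (n + 1)).series = (f ^ n).series * levelSeries f n := by
  rw [pow_succ', S0.mul_series, ← S0.substHom_apply]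
  conv_lhs => rw [f.series_eq_X_mul_divX]
  rw [map_mul, S0.substHom_X, levelSeries]

theorem red_substHom_order (f : S0 ℤ_[p]) {g : ℤ_[p]⟦X⟧} (hg : red g ≠ 0) :
    (red (f.substHom g)).order = (red g).order.toNat • (red f.series).order := by
  rw [red, S0.map_substHom, S0.order_substHom _ hg, S0.map_series]

theorem exists_level {f : S0 ℤ_[p]} {z : Disc p} (hz : z ≠ 0) {n : ℕ} (h : f ^ n • z = 0) :
    ∃ m, ev z (levelSeries f m) = 0 := by
  induction n with
  | zero => rw [pow_zero, one_smul] at h; exact absurd h hz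
  | succ n ih =>
    have h1 := congrArg Subtype.val h
    rw [smul_val, pow_succ_series, map_mul, Disc.val_zero, mul_eq_zero] at h1
    rcases h1 with h1 | h1
    · exact ih (Subtype.ext h1)
    · exact ⟨n, h1⟩

section Eisenstein

variable {f : S0 ℤ_[p]} (hf : IsEisensteinSeries f.divX)
include hf

theorem norm_linearCoeff : ‖f.linearCoeff‖ = (p : ℝ)⁻¹ := by
  rw [← S0.constantCoeff_divX]; exact hf.norm_constantCoeff

theorem norm_linearCoeff_lt_one : ‖f.linearCoeff‖ < 1 :=
  (norm_linearCoeff hf).trans_lt prime_inv_lt_one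

theorem ne_zero_of_ev_divX {z : Disc p} (hz : ev z f.divX = 0) : z ≠ 0 := by
  rintro rfl
  rw [ev_zero, S0.constantCoeff_divX] at hz
  have h := norm_ev_C (0 : Disc p) f.linearCoeff
  rw [hz, norm_linearCoeff hf] at h
  simp only [ZeroMemClass.coe_zero, norm_zero] at h
  exact prime_inv_pos.ne h

theorem red_series_ne_zero : red f.series ≠ 0 := by
  rw [f.series_eq_X_mul_divX, map_mul, map_X]
  exact mul_ne_zero X_ne_zero hf.red_ne_zero

theorem isEisensteinSeries_substHom {g : ℤ_[p]⟦X⟧} (hg : IsEisensteinSeries g) :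
    IsEisensteinSeries (f.substHom g) := by
  refine ⟨by rw [S0.constantCoeff_substHom, hg.norm_constantCoeff], fun h0 => ?_⟩
  have h := red_substHom_order f hg.red_ne_zero
  rw [h0, order_zero, ← ENat.natCast_toNat (order_finite_iff_ne_zero.2 (red_series_ne_zero hf)).ne,
    nsmul_eq_mul] at h
  exact ENat.natCast_ne_top ((red g).order.toNat * (red f.series).order.toNat)
    (by rw [h]; push_cast; rfl)

theorem isEisensteinSeries_levelSeries (n : ℕ) : IsEisensteinSeries (levelSeries f n) := by
  induction n with
  | zero => rw [levelSeries, pow_zero, S0.substHom_one]; exact hf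
  | succ n ih => rw [levelSeries_succ]; exact isEisensteinSeries_substHom hf ih

theorem ev_levelSeries_ne_zero {z : Disc p} {n : ℕ} (hz : ev z (levelSeries f (n + 1)) = 0) :
    ev z (levelSeries f n) ≠ 0 := by
  intro h
  rw [ev_levelSeries] at h
  rw [ev_levelSeries, pow_succ', mul_smul] at hz
  refine ne_zero_of_ev_divX hf hz (Subtype.ext ?_)
  rw [val_smul, h, mul_zero, Disc.val_zero]

theorem pow_smul_ne_zero {z : Disc p} {n : ℕ} (hz : ev z (levelSeries f n) = 0) :
    f ^ n • z ≠ 0 := by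
  rw [ev_levelSeries] at hz
  exact ne_zero_of_ev_divX hf hz

/-- The nonzero roots of the iterates of `f` are simple. -/
theorem ev_derivative_ne_zero {z : Disc p} {n : ℕ} (hz : ev z (levelSeries f n) = 0) :
    ev z (derivative ℤ_[p] f.series) ≠ 0 := by
  intro h
  have h1 : ev z (derivative ℤ_[p] (f ^ (n + 1)).series) = 0 := by
    rw [pow_succ, S0.derivative_mul, map_mul, h, mul_zero]
  rw [pow_succ_series, Derivation.leibniz, smul_eq_mul, smul_eq_mul, map_add, map_mul, map_mul, hz,
    zero_mul, add_zero, mul_eq_zero] at h1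
  rcases h1 with h1 | h1
  · exact pow_smul_ne_zero hf hz (Subtype.ext h1)
  · exact (isEisensteinSeries_levelSeries hf n).ev_derivative_ne_zero hz h1

/-- If `f` commutes with an invertible series of infinite order, then `f'` vanishes modulo `p`.
Otherwise `f'` has zeros in the open disc. They are permuted by `u`, so one of them, `z`, is fixed
by some power `w ≠ 1` of `u`. So are all `f^{∘n}(z)`, hence they are finite in number, and `z` is a
multiple root of an iterate of `f`. -/
theorem red_derivative_eq_zero {u : (S0 ℤ_[p])ˣ} (hcomm : f * u = u * f)
    (hu : ∀ n : ℕ, 0 < n → u ^ n ≠ 1) : red (derivative ℤ_[p] f.series) = 0 := by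
  by_contra hred
  have hE : IsEisensteinSeries (derivative ℤ_[p] f.series) :=
    ⟨by rw [S0.constantCoeff_derivative, norm_linearCoeff hf], hred⟩
  obtain ⟨z, hz⟩ := hE.exists_zero
  have hz0 : z ≠ 0 := by
    rintro rfl
    rw [ev_zero, S0.constantCoeff_derivative, ← S0.constantCoeff_divX, ← ev_zero] at hz
    exact ne_zero_of_ev_divX hf hz rfl
  have hstable : ∀ n : ℕ, ev (u ^ n • z) (derivative ℤ_[p] f.series) = 0 := by
    intro n
    induction n with
    | zero => rwa [pow_zero, one_smul]
    | succ n ih =>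
      have h1 := congrArg (fun g : S0 ℤ_[p] => ev (u ^ n • z) (derivative ℤ_[p] g.series)) hcomm
      simp only [S0.derivative_mul, map_mul, ih, mul_zero, ev_substHom] at h1
      rw [pow_succ', mul_smul]
      refine (mul_eq_zero.1 h1).resolve_right (ev_ne_zero_of_isUnit ?_ _)
      rw [isUnit_iff_norm_constantCoeff, S0.constantCoeff_derivative, norm_linearCoeff_unit]
  obtain ⟨m, n, hmn, heq⟩ : ∃ m n : ℕ, m < n ∧ u ^ m • z = u ^ n • z := by
    have hfin : {y : Disc p | ev y (derivative ℤ_[p] f.series) = 0}.Finite :=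
      finite_zeros fun h0 => hred (by rw [h0, map_zero])
    obtain ⟨m, -, n, -, hne, heq⟩ := Set.infinite_univ.exists_ne_map_eq_of_mapsTo
      (f := fun n : ℕ => u ^ n • z) (fun n _ => hstable n) hfin
    rcases hne.lt_or_gt with h | h
    · exact ⟨m, n, h, heq⟩
    · exact ⟨n, m, h, heq.symm⟩
  set w : S0 ℤ_[p] := ((u ^ (n - m) : (S0 ℤ_[p])ˣ) : S0 ℤ_[p]) with hw
  have hwz : w • z = z := by
    have h1 : u ^ m • (u ^ (n - m) • z) = u ^ m • z := by
      rw [← mul_smul, ← pow_add, heq]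
      congr 2
      omega
    exact smul_left_cancel _ h1
  have hwf : Commute w f := by
    have : Commute (u : S0 ℤ_[p]) f := hcomm.symm
    rw [hw, Units.val_pow_eq_pow_val]
    exact this.pow_left _
  have hw1 : w.series - X ≠ 0 := by
    intro h0
    refine hu (n - m) (Nat.sub_pos_of_lt hmn) (Units.ext ?_)
    exact S0.ext' (sub_eq_zero.1 h0)
  have hfix : ∀ k : ℕ, ev (f ^ k • z) (w.series - X) = 0 := by
    intro k
    rw [map_sub, ev_X, ← smul_val, ← mul_smul, (hwf.pow_right k).eq, mul_smul, hwz, sub_self]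
  obtain ⟨k, l, hkl, hkl'⟩ : ∃ k l : ℕ, k < l ∧ f ^ k • z = f ^ l • z := by
    obtain ⟨m, -, n, -, hne, heq⟩ := Set.infinite_univ.exists_ne_map_eq_of_mapsTo
      (f := fun n : ℕ => f ^ n • z) (fun n _ => hfix n) (finite_zeros hw1)
    rcases hne.lt_or_gt with h | h
    · exact ⟨m, n, h, heq⟩
    · exact ⟨n, m, h, heq.symm⟩
  have hk0 : f ^ k • z = 0 := by
    by_contra h0
    have h1 := norm_pow_smul_lt (norm_linearCoeff_lt_one hf) h0 (l - k - 1)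
    rw [← mul_smul, ← pow_add, show l - k - 1 + 1 + k = l by omega, ← hkl'] at h1
    exact lt_irrefl _ h1
  obtain ⟨j, hj⟩ := exists_level hz0 hk0
  exact ev_derivative_ne_zero hf hj hz

/-! ### Orbits of `u` on the roots of the iterates of `f` -/

/-- The zeros of `levelSeries f n` in the open disc form a single Galois orbit. -/
theorem exists_galD_eq_of_level {n : ℕ} {z w : Disc p} (hz : ev z (levelSeries f n) = 0)
    (hw : ev w (levelSeries f n) = 0) : ∃ σ : Gal(PadicAlgCl p/ℚ_[p]), galD σ z = w :=
  (isEisensteinSeries_levelSeries hf n).exists_galD_eq hz hw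

theorem order_red_levelSeries (hord : (red f.divX).order.toNat = p - 1) (n : ℕ) :
    (red (levelSeries f n)).order.toNat = p ^ n * (p - 1) := by
  have hfo : (red f.series).order = p := by
    have h1 : (red f.divX).order = ((p - 1 : ℕ) : ℕ∞) := by
      rw [← hord, ENat.natCast_toNat (order_finite_iff_ne_zero.2 hf.red_ne_zero).ne]
    rw [f.series_eq_X_mul_divX, map_mul, map_X, order_mul, order_X, h1]
    have := (Fact.out : p.Prime).one_lt
    exact_mod_cast (by omega : 1 + (p - 1) = p)
  induction n with
  | zero => rw [levelSeries, pow_zero, S0.substHom_one, hord, pow_zero, one_mul]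
  | succ n ih =>
    rw [levelSeries_succ, red_substHom_order f (isEisensteinSeries_levelSeries hf n).red_ne_zero,
      ih, hfo, nsmul_eq_mul]
    norm_cast
    rw [ENat.toNat_natCast]
    ring

theorem finite_level (n : ℕ) : {z : Disc p | ev z (levelSeries f n) = 0}.Finite :=
  finite_zeros fun h => (isEisensteinSeries_levelSeries hf n).red_ne_zero (by rw [h, map_zero])

/-- The fibre of `f` over a nonzero root of an iterate of `f` has `p` elements. -/
theorem ncard_fibre (hord : (red f.divX).order.toNat = p - 1) {n : ℕ} {x : Disc p}
    (hx : ev x (levelSeries f n) = 0) : {z : Disc p | f • z = x}.ncard = p := by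
  classical
  set A := (finite_level hf (n + 1)).toFinset with hA
  set B := (finite_level hf n).toFinset with hB
  have hAc : A.card = p ^ (n + 1) * (p - 1) := by
    rw [hA, ← Set.ncard_eq_toFinset_card _ (finite_level hf _),
      (isEisensteinSeries_levelSeries hf _).ncard_zeros,
      order_red_levelSeries hf hord]
  have hBc : B.card = p ^ n * (p - 1) := by
    rw [hB, ← Set.ncard_eq_toFinset_card _ (finite_level hf _),
      (isEisensteinSeries_levelSeries hf _).ncard_zeros,
      order_red_levelSeries hf hord]
  have hmem : ∀ z, f • z ∈ B ↔ z ∈ A := fun z => by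
    simp only [hA, hB, Set.Finite.mem_toFinset, Set.mem_ofPred_eq, ev_levelSeries_succ]
  have hfib : ∀ y ∈ B, {z : Disc p | f • z = y}.ncard = (A.filter fun z => f • z = y).card := by
    intro y hy
    rw [← Set.ncard_coe_finset]
    congr 1
    ext z
    simp only [Set.mem_ofPred_eq, Finset.coe_filter]
    refine ⟨fun h => ⟨(hmem z).1 (h ▸ hy), h⟩, fun h => h.2⟩
  have hxB : x ∈ B := by simpa [hB] using hx
  have hconst : ∀ y ∈ B, (A.filter fun z => f • z = y).card = {z : Disc p | f • z = x}.ncard := by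
    intro y hy
    rw [← hfib y hy]
    obtain ⟨σ, hσ⟩ := exists_galD_eq_of_level hf hx (w := y) (by simpa [hB] using hy)
    obtain ⟨τ, hτ⟩ := exists_galD_eq_of_level hf (w := x) (z := y) (by simpa [hB] using hy) hx
    have hfin : ∀ y ∈ B, {z : Disc p | f • z = y}.Finite := fun y hy =>
      A.finite_toSet.subset fun z (hz : f • z = y) => (hmem z).1 (hz ▸ hy)
    refine le_antisymm ?_ ?_
    · exact Set.ncard_le_ncard_of_injOn (galD τ)
        (fun z (hz : f • z = y) => show f • galD τ z = x by rw [← galD_smul, hz, hτ])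
        (galD_injective τ).injOn (hfin x hxB)
    · exact Set.ncard_le_ncard_of_injOn (galD σ)
        (fun z (hz : f • z = x) => show f • galD σ z = y by rw [← galD_smul, hz, hσ])
        (galD_injective σ).injOn (hfin y hy)
  have hsum := Finset.card_eq_sum_card_fiberwise (s := A) (t := B) (f := fun z => f • z)
    fun z hz => (hmem z).2 hz
  rw [Finset.sum_congr rfl hconst, Finset.sum_const, hAc, hBc, smul_eq_mul, pow_succ] at hsum
  have hp := (Fact.out : p.Prime)
  have hpos : 0 < p ^ n * (p - 1) := Nat.mul_pos (pow_pos hp.pos n) (Nat.sub_pos_of_lt hp.one_lt)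
  refine (Nat.eq_of_mul_eq_mul_left hpos ?_).symm
  rw [← hsum]; ring

end Eisenstein

/-! ### Fixed points of the iterates of `u` -/

/-- The quotient of `w^{∘m}(x) - x` by `w(x) - x`, for an iterate `w` of `u`, has a constant term
of the same valuation as `m`. -/
theorem exists_cofactor {u : S0 ℤ_[p]} (hu1 : u.linearCoeff ≠ 1)
    (hnorm : ∀ m : ℕ, ‖1 - u.linearCoeff ^ m‖ = ‖1 - u.linearCoeff‖ * ‖(m : ℤ_[p])‖)
    {a : ℕ} (ha : 0 < a) (m : ℕ) : ∃ h : ℤ_[p]⟦X⟧,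
      ((u ^ a) ^ m).series - X = ((u ^ a).series - X) * h ∧
        ‖constantCoeff h‖ = ‖(m : ℤ_[p])‖ := by
  obtain ⟨h, hh⟩ := series_sub_X_dvd_pow (u ^ a) m
  refine ⟨h, hh, ?_⟩
  have hlin : ∀ w : S0 ℤ_[p], w.series - X = X * (w.divX - 1) := fun w => by
    rw [mul_sub, mul_one, ← w.series_eq_X_mul_divX]
  rw [hlin, hlin, mul_assoc] at hh
  have h1 := congrArg constantCoeff (mul_left_cancel₀ X_ne_zero hh)
  simp only [map_sub, map_one, map_mul, S0.constantCoeff_divX, S0.linearCoeff_pow, ← pow_mul]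
    at h1
  have h2 := congrArg norm h1
  rw [norm_mul, norm_sub_rev, norm_sub_rev _ 1, hnorm, hnorm, Nat.cast_mul, norm_mul,
    ← mul_assoc] at h2
  refine (mul_left_cancel₀ (mul_ne_zero ?_ ?_) h2).symm
  · exact norm_ne_zero_iff.2 (sub_ne_zero.2 hu1.symm)
  · exact norm_ne_zero_iff.2 (Nat.cast_ne_zero.2 ha.ne')

/-- If an iterate `w` of `u` moves a point of the open disc which is fixed by `w^{∘m}`, then `p`
divides `m`. -/
theorem dvd_of_pow_smul_eq {u : S0 ℤ_[p]} (hu1 : u.linearCoeff ≠ 1)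
    (hnorm : ∀ m : ℕ, ‖1 - u.linearCoeff ^ m‖ = ‖1 - u.linearCoeff‖ * ‖(m : ℤ_[p])‖)
    {a : ℕ} (ha : 0 < a) {m : ℕ} {z : Disc p} (hz : u ^ a • z ≠ z) (hm : (u ^ a) ^ m • z = z) :
    p ∣ m := by
  by_contra hpm
  obtain ⟨h, hh, h0⟩ := exists_cofactor hu1 hnorm ha m
  have hunit : IsUnit h := by
    rw [isUnit_iff_norm_constantCoeff, h0]
    refine le_antisymm (PadicInt.norm_le_one _) (not_lt.1 fun hlt => hpm ?_)
    have := (PadicInt.norm_int_lt_one_iff_dvd (p := p) m).1 (by exact_mod_cast hlt)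
    exact_mod_cast this
  have h1 := congrArg (ev z) hh
  rw [map_mul, map_sub, map_sub, ev_X, ← smul_val, ← smul_val, hm, sub_self] at h1
  rcases mul_eq_zero.1 h1.symm with h2 | h2
  · exact hz (Subtype.ext (sub_eq_zero.1 h2))
  · exact ev_ne_zero_of_isUnit hunit z h2

theorem ev_levelSeries_seq {f : S0 ℤ_[p]} {t : ℕ → Disc p} (ht0 : ev (t 0) f.divX = 0)
    (hts : ∀ n, f • t (n + 1) = t n) (n : ℕ) : ev (t n) (levelSeries f n) = 0 := by
  rw [ev_levelSeries]
  have : f ^ n • t n = t 0 := by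
    induction n with
    | zero => rw [pow_zero, one_smul]
    | succ n ih => rw [pow_succ, mul_smul, hts, ih]
  rw [this, ht0]

theorem smul_seq_eq_of_le {f : S0 ℤ_[p]} {t : ℕ → Disc p}
    (hts : ∀ n, f • t (n + 1) = t n) {v : S0 ℤ_[p]} (hv : f * v = v * f) {i j : ℕ} (hij : i ≤ j)
    (h : v • t j = t j) : v • t i = t i := by
  induction j, hij using Nat.le_induction with
  | base => exact h
  | succ j _ ih =>
    refine ih ?_
    rw [← hts j, ← mul_smul, ← hv, mul_smul, h]

section Eisenstein

variable {f : S0 ℤ_[p]} (hf : IsEisensteinSeries f.divX)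
include hf

/-- If an iterate `w` of `u` fixes none of the points of level `n`, but `w^{∘p}` fixes one of them,
then `w^{∘p}` fixes none of the points of level `n + 1`: the constant term of
`(w^{∘p}(x) - x)/(w(x) - x)` is a uniformizer, so that this series is a unit times the Eisenstein
series of level `n`. -/
theorem pow_prime_smul_ne {u : S0 ℤ_[p]} (hcomm : f * u = u * f) (hu1 : u.linearCoeff ≠ 1)
    (hnorm : ∀ m : ℕ, ‖1 - u.linearCoeff ^ m‖ = ‖1 - u.linearCoeff‖ * ‖(m : ℤ_[p])‖)
    {a : ℕ} (ha : 0 < a) {n : ℕ} {z y : Disc p} (hz : ev z (levelSeries f n) = 0)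
    (hy : ev y (levelSeries f (n + 1)) = 0) (hwz : u ^ a • z ≠ z) (hpz : (u ^ a) ^ p • z = z) :
    (u ^ a) ^ p • y ≠ y := by
  intro hpy
  obtain ⟨h, hh, h0⟩ := exists_cofactor hu1 hnorm ha p
  have hE := isEisensteinSeries_levelSeries hf n
  have hhz : ev z h = 0 := by
    have h1 := congrArg (ev z) hh
    rw [map_mul, map_sub, map_sub, ev_X, ← smul_val, ← smul_val, hpz, sub_self] at h1
    exact (mul_eq_zero.1 h1.symm).resolve_left
      fun h2 => hwz (Subtype.ext (sub_eq_zero.1 h2))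
  obtain ⟨k, rfl⟩ := hE.dvd hz hhz
  have hk : IsUnit k := by
    rw [isUnit_iff_norm_constantCoeff]
    rw [map_mul, norm_mul, hE.norm_constantCoeff, PadicInt.norm_p] at h0
    exact mul_left_cancel₀ prime_inv_pos.ne' (h0.trans (mul_one _).symm)
  have hwy : u ^ a • y = y := by
    have h1 := congrArg (ev y) hh
    rw [map_mul, map_mul, map_sub, map_sub, ev_X, ← smul_val, ← smul_val, hpy, sub_self] at h1
    refine Subtype.ext (sub_eq_zero.1 ((mul_eq_zero.1 h1.symm).resolve_right ?_))
    exact mul_ne_zero (ev_levelSeries_ne_zero hf hy) (ev_ne_zero_of_isUnit hk y)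
  have hcw : Commute (u ^ a) f := (show Commute u f from hcomm.symm).pow_left a
  have hfy : u ^ a • (f • y) = f • y := by
    rw [← mul_smul, hcw.eq, mul_smul, hwy]
  rw [ev_levelSeries_succ] at hy
  obtain ⟨σ, hσ⟩ := exists_galD_eq_of_level hf hy hz
  rw [← hσ, ← galD_smul, hfy] at hwz
  exact hwz rfl

theorem linearCoeff_ne_one {u : (S0 ℤ_[p])ˣ} (hcomm : f * u = u * f)
    (hu : ∀ n : ℕ, 0 < n → u ^ n ≠ 1) : (u : S0 ℤ_[p]).linearCoeff ≠ 1 := by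
  intro h
  refine hu 1 one_pos ?_
  rw [pow_one]
  refine Units.ext (eq_of_commute hf hcomm ?_ ?_)
  · rw [Units.val_one, mul_one, one_mul]
  · rw [h, Units.val_one, S0.linearCoeff_one]

variable {t : ℕ → Disc p} (ht0 : ev (t 0) f.divX = 0) (hts : ∀ n, f • t (n + 1) = t n)
include ht0 hts

/-- A series which vanishes at `0` and at all members of a consistent sequence is divisible by all
iterates of `f`. -/
theorem pow_series_dvd {g : ℤ_[p]⟦X⟧} (h0 : constantCoeff g = 0) (hg : ∀ i, ev (t i) g = 0)
    (n : ℕ) : (f ^ n).series ∣ g := by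
  induction n with
  | zero => rw [pow_zero, S0.one_series]; exact X_dvd_iff.2 h0
  | succ n ih =>
    obtain ⟨k, rfl⟩ := ih
    have hn := ev_levelSeries_seq ht0 hts n
    have hk : ev (t n) k = 0 := by
      have h1 := hg n
      rw [map_mul] at h1
      exact (mul_eq_zero.1 h1).resolve_left fun h2 => pow_smul_ne_zero hf hn (Subtype.ext h2)
    rw [pow_succ_series]
    exact mul_dvd_mul_left _ ((isEisensteinSeries_levelSeries hf n).dvd hn hk)

theorem coeff_one_eq_zero {g : ℤ_[p]⟦X⟧} (h0 : constantCoeff g = 0)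
    (hg : ∀ i, ev (t i) g = 0) : coeff 1 g = 0 := by
  refine norm_le_zero_iff.1 (ge_of_tendsto' (tendsto_pow_atTop_nhds_zero_of_lt_one
    (prime_inv_pos (p := p)).le prime_inv_lt_one) fun n => ?_)
  obtain ⟨k, hk⟩ := pow_series_dvd hf ht0 hts h0 hg n
  rw [hk, S0.series_eq_X_mul_divX, mul_assoc, coeff_succ_X_mul, coeff_zero_eq_constantCoeff_apply,
    map_mul, S0.constantCoeff_divX, S0.linearCoeff_pow, norm_mul, norm_pow, norm_linearCoeff hf]
  exact mul_le_of_le_one_right (pow_nonneg prime_inv_pos.le n) (PadicInt.norm_le_one _)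

/-- A series commuting with `f` is determined by its values on a consistent sequence. -/
theorem eq_of_smul_seq_eq {v w : S0 ℤ_[p]} (hv : f * v = v * f) (hw : f * w = w * f)
    (h : ∀ i, v • t i = w • t i) : v = w := by
  refine eq_of_commute hf hv hw (sub_eq_zero.1 ?_)
  have := coeff_one_eq_zero hf ht0 hts (g := v.series - w.series)
    (by rw [map_sub, v.constantCoeff_series, w.constantCoeff_series, sub_self])
    fun i => by rw [map_sub, ← smul_val, ← smul_val, h, sub_self]
  rwa [map_sub] at this

variable {u : (S0 ℤ_[p])ˣ} (hcomm : f * u = u * f) (hu : ∀ n : ℕ, 0 < n → u ^ n ≠ 1)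
include hcomm hu

/-- `u` does not fix all members of a consistent sequence. -/
theorem exists_smul_seq_ne : ∃ i, u • t i ≠ t i := by
  by_contra! h
  refine hu 1 one_pos ?_
  rw [pow_one]
  refine Units.ext (eq_of_smul_seq_eq hf ht0 hts hcomm ?_ fun i => ?_)
  · rw [Units.val_one, mul_one, one_mul]
  · rw [Units.val_one, one_smul]; exact h i

end Eisenstein

/-- If `w` is an iterate of `u` which moves `z`, the points `z, w(z), …, w^{∘(p-1)}(z)` are
distinct. -/
theorem injOn_pow_smul {u : S0 ℤ_[p]} (hu1 : u.linearCoeff ≠ 1)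
    (hnorm : ∀ m : ℕ, ‖1 - u.linearCoeff ^ m‖ = ‖1 - u.linearCoeff‖ * ‖(m : ℤ_[p])‖)
    (hinj : ∀ x y : Disc p, u • x = u • y → x = y)
    {a : ℕ} (ha : 0 < a) {z : Disc p} (hz : u ^ a • z ≠ z) :
    Set.InjOn (fun i => (u ^ a) ^ i • z) (Finset.range p : Set ℕ) := by
  have hinj' : ∀ (n : ℕ) (x y : Disc p), u ^ n • x = u ^ n • y → x = y := by
    intro n
    induction n with
    | zero => intro x y h; simpa using h
    | succ n ih =>
      intro x y h
      rw [pow_succ', mul_smul, mul_smul] at h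
      exact ih x y (hinj _ _ h)
  have key : ∀ i j : ℕ, i < j → j < p → (u ^ a) ^ i • z ≠ (u ^ a) ^ j • z := by
    intro i j hij hj h
    have h1 : (u ^ a) ^ (j - i) • z = z := by
      refine (hinj' (a * i) _ _ ?_).symm
      rwa [← mul_smul, pow_mul, ← pow_add, Nat.add_sub_of_le hij.le]
    have h2 := Nat.le_of_dvd (by omega) (dvd_of_pow_smul_eq hu1 hnorm ha hz h1)
    omega
  intro i hi j hj h
  simp only [Finset.coe_range, Set.mem_Iio] at hi hj
  by_contra hne
  rcases Ne.lt_or_gt hne with h' | h'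
  · exact key i j h' hj h
  · exact key j i h' hi h.symm

theorem galD_seq_eq_of_le {f : S0 ℤ_[p]} {t : ℕ → Disc p} (hts : ∀ n, f • t (n + 1) = t n)
    {σ : Gal(PadicAlgCl p/ℚ_[p])} {i j : ℕ} (hij : i ≤ j) (h : galD σ (t j) = t j) :
    galD σ (t i) = t i := by
  induction j, hij using Nat.le_induction with
  | base => exact h
  | succ j _ ih => exact ih (by rw [← hts j, galD_smul, h])

section Eisenstein

variable {f : S0 ℤ_[p]} (hf : IsEisensteinSeries f.divX)
  (hord : (red f.divX).order.toNat = p - 1)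
  {u : (S0 ℤ_[p])ˣ} (hcomm : f * u = u * f) (hu : ∀ n : ℕ, 0 < n → u ^ n ≠ 1)
  (hnorm : ∀ m : ℕ, ‖1 - (u : S0 ℤ_[p]).linearCoeff ^ m‖ =
    ‖1 - (u : S0 ℤ_[p]).linearCoeff‖ * ‖(m : ℤ_[p])‖)
  {t : ℕ → Disc p} (ht0 : ev (t 0) f.divX = 0) (hts : ∀ n, f • t (n + 1) = t n)
include hf hord hcomm hu hnorm ht0

/-- `u` fixes the nonzero roots of `f`. -/
theorem smul_seq_zero : u • t 0 = t 0 := by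
  by_contra hne
  have hinj := injOn_pow_smul (linearCoeff_ne_one hf hcomm hu) hnorm
    (fun x y h => smul_left_cancel u h) one_pos (z := t 0) (by rwa [pow_one])
  have hmaps : ∀ n : ℕ, ev (((u : S0 ℤ_[p]) ^ 1) ^ n • t 0) f.divX = 0 := by
    intro n
    rw [pow_one]
    have h1 : f • ((u : S0 ℤ_[p]) ^ n • t 0) = 0 := by
      have hc : Commute f ((u : S0 ℤ_[p]) ^ n) :=
        (show Commute f (u : S0 ℤ_[p]) from hcomm).pow_right n
      have h0 : f • t 0 = 0 := Subtype.ext (by rw [val_smul, ht0, mul_zero, Disc.val_zero])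
      rw [← mul_smul, hc.eq, mul_smul, h0, smul_zero']
    have h2 := congrArg Subtype.val h1
    rw [val_smul, Disc.val_zero, mul_eq_zero] at h2
    refine h2.resolve_left fun h3 => ne_zero_of_ev_divX hf ht0 ?_
    have h4 : (u : S0 ℤ_[p]) ^ n • t 0 = 0 := Subtype.ext h3
    rw [← Units.val_pow_eq_pow_val] at h4
    exact smul_left_cancel (u ^ n) (h4.trans (smul_zero' _).symm)
  have hfin : {z : Disc p | ev z f.divX = 0}.Finite :=
    finite_zeros fun h => hf.red_ne_zero (by rw [h, map_zero])
  have hcard := Set.ncard_le_ncard_of_injOn _ (fun i _ => hmaps i) hinj hfin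
  rw [hf.ncard_zeros, hord, Set.ncard_coe_finset, Finset.card_range] at hcard
  have := (Fact.out : p.Prime).pos
  omega

include hts

/-- One step up the tower: if the iterate `w` of `u` fixes `t n` but moves `t (n + 1)`, then it
permutes the fibre of `f` above `t n` transitively, and `w^{∘p}` fixes `t (n + 1)` but moves
`t (n + 2)`. -/
theorem fibre_step {a : ℕ} (ha : 0 < a) {n : ℕ} (h1 : (u : S0 ℤ_[p]) ^ a • t n = t n)
    (h2 : (u : S0 ℤ_[p]) ^ a • t (n + 1) ≠ t (n + 1)) :
    (∀ y, f • y = t n → ∃ i : ℕ, ((u : S0 ℤ_[p]) ^ a) ^ i • t (n + 1) = y) ∧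
    ((u : S0 ℤ_[p]) ^ a) ^ p • t (n + 1) = t (n + 1) ∧
    ((u : S0 ℤ_[p]) ^ a) ^ p • t (n + 2) ≠ t (n + 2) := by
  classical
  have hu1 := linearCoeff_ne_one hf hcomm hu
  have hinj := injOn_pow_smul hu1 hnorm (fun x y h => smul_left_cancel u h) ha h2
  set w := (u : S0 ℤ_[p]) ^ a with hw
  have hc : Commute f w := (show Commute f (u : S0 ℤ_[p]) from hcomm).pow_right a
  have hmaps : ∀ i : ℕ, f • (w ^ i • t (n + 1)) = t n := by
    intro i
    rw [← mul_smul, (hc.pow_right i).eq, mul_smul, hts]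
    induction i with
    | zero => rw [pow_zero, one_smul]
    | succ i ih => rw [pow_succ, mul_smul, h1, ih]
  have hlev := ev_levelSeries_seq ht0 hts
  have hcard := ncard_fibre hf hord (hlev n)
  have hfin : {z : Disc p | f • z = t n}.Finite :=
    Set.finite_of_ncard_pos (by rw [hcard]; exact (Fact.out : p.Prime).pos)
  have himg : (fun i => w ^ i • t (n + 1)) '' (Finset.range p : Set ℕ) =
      {z : Disc p | f • z = t n} := by
    refine Set.eq_of_subset_of_ncard_le ?_ ?_ hfin
    · rintro _ ⟨i, -, rfl⟩
      exact hmaps i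
    · rw [hinj.ncard_image, Set.ncard_coe_finset, Finset.card_range, hcard]
  have hsurj : ∀ y, f • y = t n → ∃ i < p, w ^ i • t (n + 1) = y := by
    intro y hy
    have : y ∈ (fun i => w ^ i • t (n + 1)) '' (Finset.range p : Set ℕ) := himg ▸ hy
    obtain ⟨i, hi, rfl⟩ := this
    exact ⟨i, Finset.mem_range.1 hi, rfl⟩
  have hper : w ^ p • t (n + 1) = t (n + 1) := by
    obtain ⟨i, hip, hi⟩ := hsurj _ (hmaps p)
    rcases Nat.eq_zero_or_pos i with rfl | hi0
    · rw [pow_zero, one_smul] at hi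
      exact hi.symm
    · exfalso
      have h3 : w ^ (p - i) • t (n + 1) = t (n + 1) := by
        have h4 : (u ^ a) ^ i • (w ^ (p - i) • t (n + 1)) = (u ^ a) ^ i • t (n + 1) := by
          rw [Units.smul_def, Units.smul_def, Units.val_pow_eq_pow_val, Units.val_pow_eq_pow_val,
            ← hw, hi, ← mul_smul, ← pow_add,
            Nat.add_sub_of_le hip.le]
        exact smul_left_cancel _ h4
      have h5 := Nat.le_of_dvd (by omega) (dvd_of_pow_smul_eq hu1 hnorm ha h2 h3)
      omega
  refine ⟨fun y hy => ?_, hper, ?_⟩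
  · obtain ⟨i, -, hi⟩ := hsurj y hy
    exact ⟨i, hi⟩
  · exact pow_prime_smul_ne hf hcomm hu1 hnorm ha (hlev (n + 1)) (hlev (n + 2)) h2 hper

/-- Galois conjugates over `K` of members of a consistent sequence lie in the same orbit under
`u`. -/
theorem exists_zpow_smul_seq_eq {κ : ℕ} (h1 : u • t κ = t κ) (h2 : u • t (κ + 1) ≠ t (κ + 1))
    {σ : Gal(PadicAlgCl p/ℚ_[p])} (hσ : galD σ (t κ) = t κ) (i : ℕ) :
    ∃ n : ℤ, u ^ n • t i = galD σ (t i) := by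
  have hstep : ∀ j : ℕ, (u : S0 ℤ_[p]) ^ (p ^ j) • t (κ + j) = t (κ + j) ∧
      (u : S0 ℤ_[p]) ^ (p ^ j) • t (κ + j + 1) ≠ t (κ + j + 1) := by
    intro j
    induction j with
    | zero =>
      rw [pow_zero, pow_one]
      exact ⟨h1, h2⟩
    | succ j ih =>
      have := fibre_step hf hord hcomm hu hnorm ht0 hts
        (pow_pos (Fact.out : p.Prime).pos j) ih.1 ih.2
      rw [pow_succ, pow_mul]
      exact this.2
  rcases le_total i κ with hi | hi
  · refine ⟨0, ?_⟩
    rw [zpow_zero, one_smul, galD_seq_eq_of_le hts hi hσ]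
  · induction i, hi using Nat.le_induction with
    | base => exact ⟨0, by rw [zpow_zero, one_smul, hσ]⟩
    | succ i hi ih =>
      obtain ⟨n, hn⟩ := ih
      obtain ⟨j, rfl⟩ := Nat.exists_eq_add_of_le hi
      obtain ⟨hs1, hs2⟩ := hstep j
      have hcn : f * ((u ^ n : (S0 ℤ_[p])ˣ) : S0 ℤ_[p]) = ((u ^ n : (S0 ℤ_[p])ˣ) : S0 ℤ_[p]) * f :=
        ((show Commute f (u : S0 ℤ_[p]) from hcomm).units_zpow_right n).eq
      have hy : f • (u ^ (-n) • galD σ (t (κ + j + 1))) = t (κ + j) := by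
        refine smul_left_cancel (u ^ n) ?_
        rw [hn, Units.smul_def, ← mul_smul, ← hcn, mul_smul, ← Units.smul_def, ← mul_smul,
          ← zpow_add, add_neg_cancel, zpow_zero, one_smul, ← galD_smul, hts]
      obtain ⟨m, hm⟩ := (fibre_step hf hord hcomm hu hnorm ht0 hts
        (pow_pos (Fact.out : p.Prime).pos j) hs1 hs2).1 _ hy
      refine ⟨n + (p ^ j * m : ℕ), ?_⟩
      rw [zpow_add, mul_smul, zpow_natCast]
      have : (u ^ (p ^ j * m)) • t (κ + j + 1) = u ^ (-n) • galD σ (t (κ + j + 1)) := by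
        rw [← hm, ← pow_mul, Units.smul_def, Units.val_pow_eq_pow_val]
      rw [this, ← mul_smul, ← zpow_add, add_neg_cancel, zpow_zero, one_smul]

end Eisenstein

end HeightOne

namespace HeightOne

open PowerSeries Filter Topology

variable {p : ℕ} [Fact p.Prime]

/-! ### The closed subgroup generated by `u` -/

variable (p) in
/-- The ideals `(p ^ N, x ^ N)` of `ℤ_p⟦x⟧`, which define the topology of coefficientwise
convergence. -/
def nbhdIdeal (N : ℕ) : Ideal ℤ_[p]⟦X⟧ := Ideal.span {C (p : ℤ_[p]) ^ N, X ^ N}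

theorem mem_nbhdIdeal_of_coeff {N : ℕ} {d : ℤ_[p]⟦X⟧}
    (h : ∀ i < N, (p : ℤ_[p]) ^ N ∣ coeff i d) : d ∈ nbhdIdeal p N := by
  choose b hb using fun i : ℕ => show ∃ b, i < N → coeff i d = (p : ℤ_[p]) ^ N * b by
    by_cases hi : i < N
    · obtain ⟨b, hb⟩ := h i hi
      exact ⟨b, fun _ => hb⟩
    · exact ⟨0, fun h' => absurd h' hi⟩
  obtain ⟨k, hk⟩ : X ^ N ∣ d - C (p : ℤ_[p]) ^ N * PowerSeries.mk b := by
    rw [X_pow_dvd_iff]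
    intro i hi
    rw [map_sub, ← map_pow, coeff_C_mul, coeff_mk, hb i hi, sub_self]
  rw [eq_add_of_sub_eq hk]
  refine Ideal.add_mem _ (Ideal.mul_mem_right _ _ (Ideal.subset_span (by simp)))
    (Ideal.mul_mem_right _ _ (Ideal.subset_span (by simp)))

theorem exists_of_mem_nbhdIdeal {N : ℕ} {d : ℤ_[p]⟦X⟧} (h : d ∈ nbhdIdeal p N) :
    ∃ a b, d = C ((p : ℤ_[p]) ^ N) * a + X ^ N * b := by
  obtain ⟨a, b, hab⟩ := Ideal.mem_span_pair.1 h
  exact ⟨a, b, by rw [← hab, map_pow]; ring⟩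

theorem coeff_dvd_of_mem_nbhdIdeal {N i : ℕ} (hi : i < N) {d : ℤ_[p]⟦X⟧}
    (h : d ∈ nbhdIdeal p N) : (p : ℤ_[p]) ^ N ∣ coeff i d := by
  obtain ⟨a, b, rfl⟩ := exists_of_mem_nbhdIdeal h
  rw [map_add, coeff_C_mul, coeff_X_pow_mul', if_neg (not_le.2 hi), add_zero]
  exact dvd_mul_right _ _

theorem padicInt_eq_zero_of_forall_pow_dvd {a : ℤ_[p]} (h : ∃ M, ∀ N, M ≤ N → (p : ℤ_[p]) ^ N ∣ a) :
    a = 0 := by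
  obtain ⟨M, h⟩ := h
  by_contra h0
  have h1 := h (M + a.valuation + 1) (by omega)
  rw [← Ideal.mem_span_singleton, PadicInt.mem_span_pow_iff_le_valuation _ h0] at h1
  omega

theorem eq_zero_of_forall_mem_nbhdIdeal {d : ℤ_[p]⟦X⟧} (h : ∀ N, d ∈ nbhdIdeal p N) : d = 0 :=
  PowerSeries.ext fun i => padicInt_eq_zero_of_forall_pow_dvd
    ⟨i + 1, fun N hN => coeff_dvd_of_mem_nbhdIdeal hN (h N)⟩

theorem norm_ev_le_of_mem_nbhdIdeal {N : ℕ} {d : ℤ_[p]⟦X⟧} (h : d ∈ nbhdIdeal p N) (z : Disc p) :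
    ‖(ev z d : ℂ_[p])‖ ≤ max ((p : ℝ)⁻¹) ‖(z.1 : ℂ_[p])‖ ^ N := by
  obtain ⟨a, b, rfl⟩ := exists_of_mem_nbhdIdeal h
  rw [map_add, map_mul, map_mul, map_pow, map_pow, map_pow, ev_X]
  push_cast
  refine (IsUltrametricDist.norm_add_le_max _ _).trans (max_le ?_ ?_)
  · rw [norm_mul, norm_pow, norm_ev_C, PadicInt.norm_p]
    exact (mul_le_of_le_one_right (pow_nonneg prime_inv_pos.le N) (norm_le_one _)).trans
      (pow_le_pow_left₀ prime_inv_pos.le (le_max_left _ _) N)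
  · rw [norm_mul, norm_pow]
    exact (mul_le_of_le_one_right (pow_nonneg (norm_nonneg _) N) (norm_le_one _)).trans
      (pow_le_pow_left₀ (norm_nonneg _) (le_max_right _ _) N)

open scoped PowerSeries.WithPiTopology in
theorem mem_nhds_nbhdIdeal (v : ℤ_[p]⟦X⟧) (N : ℕ) : {g | g - v ∈ nbhdIdeal p N} ∈ 𝓝 v := by
  have h1 : ∀ i ∈ Finset.range N, ∀ᶠ g in 𝓝 v, ‖coeff i g - coeff i v‖ < (p : ℝ) ^ (-N : ℤ) := by
    intro i _
    have hc : Continuous fun g : ℤ_[p]⟦X⟧ => ‖coeff i g - coeff i v‖ :=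
      ((WithPiTopology.continuous_coeff ℤ_[p] i).sub continuous_const).norm
    refine hc.continuousAt.eventually_lt continuousAt_const ?_
    rw [sub_self, norm_zero]
    exact zpow_pos (by exact_mod_cast (Fact.out : p.Prime).pos) _
  filter_upwards [(Finset.range N).eventually_all.2 h1] with g hg
  refine mem_nbhdIdeal_of_coeff fun i hi => ?_
  rw [map_sub, ← Ideal.mem_span_singleton, ← PadicInt.norm_le_pow_iff_mem_span_pow]
  exact (hg i (Finset.mem_range.2 hi)).le

theorem exists_zpow_sub_mem {u : (S0 ℤ_[p])ˣ} {v : S0 ℤ_[p]} (hv : v ∈ zpIterates u) (N : ℕ) :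
    ∃ n : ℤ, ((u ^ n : (S0 ℤ_[p])ˣ) : S0 ℤ_[p]).series - v.series ∈ nbhdIdeal p N := by
  obtain ⟨_, hg, n, rfl⟩ := (@mem_closure_iff_nhds _
    (PowerSeries.WithPiTopology.instTopologicalSpace ℤ_[p]) _ _).1 hv _
    (mem_nhds_nbhdIdeal v.series N)
  exact ⟨n, hg⟩

/-- The elements of `u^{∘ℤ_p}` commute with everything that commutes with `u`. -/
theorem commute_of_mem_zpIterates {f : S0 ℤ_[p]} {u : (S0 ℤ_[p])ˣ} (hcomm : f * u = u * f)
    {v : S0 ℤ_[p]} (hv : v ∈ zpIterates u) : f * v = v * f := by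
  refine S0.ext' (sub_eq_zero.1 (eq_zero_of_forall_mem_nbhdIdeal fun N => ?_))
  obtain ⟨n, hn⟩ := exists_zpow_sub_mem hv N
  set w : S0 ℤ_[p] := ((u ^ n : (S0 ℤ_[p])ˣ) : S0 ℤ_[p])
  have hw : f * w = w * f := ((show Commute f (u : S0 ℤ_[p]) from hcomm).units_zpow_right n).eq
  have h1 : (f * w).series - (f * v).series ∈ nbhdIdeal p N := by
    rw [S0.mul_series, S0.mul_series, ← S0.substHom_apply, ← S0.substHom_apply]
    exact substHom_sub_substHom_mem _ hn _
  have h2 : (w * f).series - (v * f).series ∈ nbhdIdeal p N := by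
    rw [S0.mul_series, S0.mul_series, ← S0.substHom_apply, ← S0.substHom_apply, ← map_sub]
    obtain ⟨a, b, hab⟩ := exists_of_mem_nbhdIdeal hn
    rw [hab, map_add, map_mul, map_mul, S0.substHom_C, map_pow, map_pow, S0.substHom_X,
      f.series_eq_X_mul_divX, mul_pow, mul_assoc]
    exact Ideal.add_mem _ (Ideal.mul_mem_right _ _ (Ideal.subset_span (by simp)))
      (Ideal.mul_mem_right _ _ (Ideal.subset_span (by simp)))
  rw [hw] at h1
  have := Ideal.sub_mem _ h2 h1
  rwa [sub_sub_sub_cancel_left] at this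

open scoped PowerSeries.WithPiTopology in
/-- By compactness, a family of points `y i` which for each `i` are the images of `t 0, …, t i`
under an iterate of `u` is the image of the family `t` under an element of `u^{∘ℤ_p}`. -/
theorem exists_mem_zpIterates_smul_eq {u : (S0 ℤ_[p])ˣ} {t y : ℕ → Disc p}
    (h : ∀ i, ∃ n : ℤ, ∀ j ≤ i, u ^ n • t j = y j) :
    ∃ v ∈ zpIterates u, ∀ i, v • t i = y i := by
  choose n hn using h
  have hcomp : CompactSpace ℤ_[p]⟦X⟧ :=
    inferInstanceAs (CompactSpace ((Unit →₀ ℕ) → ℤ_[p]))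
  obtain ⟨v, hv⟩ := exists_clusterPt_of_compactSpace
    (map (fun i => ((u ^ n i : (S0 ℤ_[p])ˣ) : S0 ℤ_[p]).series) atTop)
  have hv' : MapClusterPt v atTop fun i => ((u ^ n i : (S0 ℤ_[p])ˣ) : S0 ℤ_[p]).series := hv
  have hclose : ∀ N J : ℕ, ∃ j ≥ J,
      ((u ^ n j : (S0 ℤ_[p])ˣ) : S0 ℤ_[p]).series - v ∈ nbhdIdeal p N := fun N J =>
    frequently_atTop.1 (hv'.frequently (mem_nhds_nbhdIdeal v N)) J
  have h0 : constantCoeff v = 0 := by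
    refine padicInt_eq_zero_of_forall_pow_dvd ⟨1, fun N hN => ?_⟩
    obtain ⟨j, -, hj⟩ := hclose N 0
    have := coeff_dvd_of_mem_nbhdIdeal hN hj
    rwa [map_sub, coeff_zero_eq_constantCoeff_apply, coeff_zero_eq_constantCoeff_apply,
      S0.constantCoeff_series, zero_sub, dvd_neg] at this
  refine ⟨⟨v, h0⟩, ?_, fun i => ?_⟩
  · refine mem_closure_iff_nhds.2 fun U hU => ?_
    obtain ⟨i, hi⟩ := (hv'.frequently hU).exists
    exact ⟨_, hi, n i, rfl⟩
  · refine Subtype.ext (sub_eq_zero.1 (Subtype.ext (norm_le_zero_iff.1 ?_)))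
    refine ge_of_tendsto' (tendsto_pow_atTop_nhds_zero_of_lt_one
      (prime_inv_pos.le.trans (le_max_left _ _)) (max_lt (prime_inv_lt_one (p := p)) (t i).2))
      fun N => ?_
    obtain ⟨j, hij, hj⟩ := hclose N i
    have := norm_ev_le_of_mem_nbhdIdeal hj (t i)
    rwa [map_sub, ← smul_val, ← Units.smul_def, hn j i hij, ← neg_sub, NegMemClass.coe_neg,
      norm_neg] at this

end HeightOne

namespace HeightOne

open PowerSeries

variable {p : ℕ} [Fact p.Prime]

/-! ### Height one pairs -/

theorem roots_eq_insert (f : S0 ℤ_[p]) :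
    {z : Disc p | ev z f.series = 0} = insert 0 {z : Disc p | ev z f.divX = 0} := by
  ext z
  simp only [Set.mem_ofPred_eq, Set.mem_insert_iff]
  rw [f.series_eq_X_mul_divX, map_mul, ev_X, mul_eq_zero]
  exact or_congr_left ⟨fun h => Subtype.ext h, fun h => by rw [h, Disc.val_zero]⟩

namespace IsHeightOnePair

variable {f : S0 ℤ_[p]} {u : (S0 ℤ_[p])ˣ} (hfu : IsHeightOnePair f u)
include hfu

theorem norm_linearCoeff : ‖f.linearCoeff‖ = (p : ℝ)⁻¹ := by
  have h0 : f.linearCoeff ≠ 0 := by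
    intro h
    have := hfu.valuation_linearCoeff
    rw [h, PadicInt.valuation_zero] at this
    exact zero_ne_one this
  rw [PadicInt.norm_eq_zpow_neg_valuation h0, hfu.valuation_linearCoeff, Nat.cast_one, zpow_neg_one]

theorem ncard_roots_disc : {z : Disc p | ev z f.series = 0}.ncard = p := by
  refine Eq.trans ?_ hfu.ncard_roots
  rw [← Set.ncard_image_of_injective _ Subtype.val_injective]
  congr 1
  ext z
  constructor
  · rintro ⟨z, hz, rfl⟩
    exact ⟨z.2, hz⟩
  · rintro ⟨h1, h2⟩
    exact ⟨⟨z, h1⟩, h2, rfl⟩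

/-- If `f` were divisible by `p`, then it would have no root besides `0` in the open disc. -/
theorem isEisensteinSeries_divX : IsEisensteinSeries f.divX := by
  refine ⟨by rw [S0.constantCoeff_divX, hfu.norm_linearCoeff], fun h => ?_⟩
  obtain ⟨g, hg⟩ := (red_eq_zero_iff _).1 h
  have hgu : IsUnit g := by
    rw [isUnit_iff_norm_constantCoeff]
    have h1 := hfu.norm_linearCoeff
    rw [← S0.constantCoeff_divX, hg, map_mul, constantCoeff_C, norm_mul, PadicInt.norm_p] at h1
    exact mul_left_cancel₀ prime_inv_pos.ne' (h1.trans (mul_one _).symm)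
  have hempty : {z : Disc p | ev z f.divX = 0} = ∅ := by
    refine Set.eq_empty_iff_forall_notMem.2 fun z (hz : ev z f.divX = 0) => ?_
    rw [hg, map_mul, mul_eq_zero] at hz
    refine hz.elim (fun h0 => ?_) (ev_ne_zero_of_isUnit hgu z)
    have h1 := norm_ev_C z (p : ℤ_[p])
    rw [h0, PadicInt.norm_p, ZeroMemClass.coe_zero, norm_zero] at h1
    exact prime_inv_pos.ne h1
  have h1 := hfu.ncard_roots_disc
  rw [roots_eq_insert, hempty, insert_empty_eq, Set.ncard_singleton] at h1
  exact (Fact.out : p.Prime).one_lt.ne h1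

theorem order_red_divX : (red f.divX).order.toNat = p - 1 := by
  have hE := hfu.isEisensteinSeries_divX
  have h1 := hfu.ncard_roots_disc
  have hfin : {z : Disc p | ev z f.divX = 0}.Finite :=
    finite_zeros fun h => hE.red_ne_zero (by rw [h, map_zero])
  have h0 : (0 : Disc p) ∉ {z : Disc p | ev z f.divX = 0} := fun h => ne_zero_of_ev_divX hE h rfl
  rw [roots_eq_insert, Set.ncard_insert_of_notMem h0 hfin, hE.ncard_zeros] at h1
  omega

end IsHeightOnePair

/-- A consistent sequence, as a sequence of points of the open disc. -/
def IsConsistent.seq {f : S0 ℤ_[p]} {s : ℕ → 𝓞_ℂ_[p]} (hs : IsConsistent f s) (i : ℕ) : Disc p :=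
  ⟨s i, hs.norm_lt_one i⟩

section Consistent

variable {f : S0 ℤ_[p]} {s : ℕ → 𝓞_ℂ_[p]} (hs : IsConsistent f s)

theorem IsConsistent.seq_val (i : ℕ) : (hs.seq i).1 = s i := rfl

theorem IsConsistent.smul_seq_succ (i : ℕ) : f • hs.seq (i + 1) = hs.seq i :=
  Subtype.ext (hs.succ i)

theorem IsConsistent.ev_seq_zero (hs0 : s 0 ≠ 0) : ev (hs.seq 0) f.divX = 0 := by
  have h := hs.zero
  change ev (hs.seq 0) f.series = 0 at h
  rw [f.series_eq_X_mul_divX, map_mul, ev_X, mul_eq_zero] at h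
  exact h.resolve_left hs0

theorem isUSigma_iff {u : (S0 ℤ_[p])ˣ} {σ : Gal(PadicAlgCl p/ℚ_[p])} {v : S0 ℤ_[p]} :
    IsUSigma u s σ v ↔ v ∈ zpIterates u ∧ ∀ i, v • hs.seq i = galD σ (hs.seq i) :=
  and_congr_right fun _ => forall_congr' fun i =>
    (Subtype.ext_iff (a1 := v • hs.seq i) (a2 := galD σ (hs.seq i))).symm

end Consistent

namespace IsHeightOnePair

variable {f : S0 ℤ_[p]} {u : (S0 ℤ_[p])ˣ} (hfu : IsHeightOnePair f u) {s : ℕ → 𝓞_ℂ_[p]}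
  (hs : IsConsistent f s) (hs0 : s 0 ≠ 0)
include hfu hs hs0

theorem smul_seq_fixedIndex : u • hs.seq (fixedIndex u s) = hs.seq (fixedIndex u s) ∧
    u • hs.seq (fixedIndex u s + 1) ≠ hs.seq (fixedIndex u s + 1) := by
  have hE := hfu.isEisensteinSeries_divX
  have ht0 := hs.ev_seq_zero hs0
  have hts := hs.smul_seq_succ
  have hset : {k : ℕ | evalInt (u : S0 ℤ_[p]).series (s k) = s k} =
      {k : ℕ | u • hs.seq k = hs.seq k} :=
    Set.ext fun k => (Subtype.ext_iff (a1 := u • hs.seq k) (a2 := hs.seq k)).symm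
  have hne : {k : ℕ | u • hs.seq k = hs.seq k}.Nonempty :=
    ⟨0, smul_seq_zero hE hfu.order_red_divX hfu.comm hfu.infinite_order hfu.norm_one_sub_pow ht0⟩
  obtain ⟨i, hi⟩ := exists_smul_seq_ne hE ht0 hts hfu.comm hfu.infinite_order
  have hbdd : BddAbove {k : ℕ | u • hs.seq k = hs.seq k} :=
    ⟨i, fun k hk => le_of_not_ge fun hik => hi (smul_seq_eq_of_le hts hfu.comm hik hk)⟩
  rw [fixedIndex, hset]
  exact ⟨Nat.sSup_mem hne hbdd, fun h => (Nat.lt_succ_self _).not_ge (le_csSup hbdd h)⟩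

theorem exists_isUSigma {σ : Gal(PadicAlgCl p/ℚ_[p])} (hσ : InGK u s σ) :
    ∃ v, IsUSigma u s σ v := by
  have hE := hfu.isEisensteinSeries_divX
  have ht0 := hs.ev_seq_zero hs0
  have hts := hs.smul_seq_succ
  obtain ⟨h1, h2⟩ := hfu.smul_seq_fixedIndex hs hs0
  have hσ' : galD σ (hs.seq (fixedIndex u s)) = hs.seq (fixedIndex u s) :=
    Subtype.ext (Subtype.ext (hσ _ (IntermediateField.mem_adjoin_simple_self ℚ_[p] _)))
  obtain ⟨v, hv, hvt⟩ := exists_mem_zpIterates_smul_eq (u := u) (t := hs.seq)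
    (y := fun i => galD σ (hs.seq i)) fun i => by
      obtain ⟨n, hn⟩ := exists_zpow_smul_seq_eq hE hfu.order_red_divX hfu.comm
        hfu.infinite_order hfu.norm_one_sub_pow ht0 hts h1 h2 hσ' i
      refine ⟨n, fun j hj => ?_⟩
      clear h1 h2 hσ'
      induction i, hj using Nat.le_induction with
      | base => exact hn
      | succ i _ ih =>
        refine ih ?_
        have hc := ((show Commute f (u : S0 ℤ_[p]) from hfu.comm).units_zpow_right n).eq
        rw [Units.smul_def, ← hts i, ← mul_smul, ← hc, mul_smul, ← Units.smul_def, hn, galD_smul]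
  exact ⟨v, (isUSigma_iff hs).2 ⟨hv, hvt⟩⟩

theorem existsUnique_isUSigma {σ : Gal(PadicAlgCl p/ℚ_[p])} (hσ : InGK u s σ) :
    ∃! v, IsUSigma u s σ v := by
  obtain ⟨v, hv⟩ := hfu.exists_isUSigma hs hs0 hσ
  refine ⟨v, hv, fun w hw => ?_⟩
  rw [isUSigma_iff hs] at hv hw
  exact eq_of_smul_seq_eq hfu.isEisensteinSeries_divX (hs.ev_seq_zero hs0) hs.smul_seq_succ
    (commute_of_mem_zpIterates hfu.comm hw.1) (commute_of_mem_zpIterates hfu.comm hv.1)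
    fun i => (hw.2 i).trans (hv.2 i).symm

theorem isBracket_epsilon_isUSigma {σ : Gal(PadicAlgCl p/ℚ_[p])} (hσ : InGK u s σ) :
    IsUSigma u s σ (Classical.epsilon (IsUSigma u s σ)) ∧
      IsBracket u (chi u s σ) (Classical.epsilon (IsUSigma u s σ)) := by
  have h := Classical.epsilon_spec (hfu.exists_isUSigma hs hs0 hσ)
  exact ⟨h, h.1, rfl⟩

theorem existsUnique_isBracket {σ : Gal(PadicAlgCl p/ℚ_[p])} (hσ : InGK u s σ) :
    ∃! v, IsBracket u (chi u s σ) v := by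
  obtain ⟨-, h⟩ := hfu.isBracket_epsilon_isUSigma hs hs0 hσ
  exact ⟨_, h, fun w hw => eq_of_commute hfu.isEisensteinSeries_divX
    (commute_of_mem_zpIterates hfu.comm hw.1) (commute_of_mem_zpIterates hfu.comm h.1)
    (hw.2.trans h.2.symm)⟩

/-- `[χ_f(σ)]_f = u_σ`. -/
theorem isUSigma_bracket {σ : Gal(PadicAlgCl p/ℚ_[p])} (hσ : InGK u s σ) :
    IsUSigma u s σ (bracket u (chi u s σ)) := by
  obtain ⟨h1, h2⟩ := hfu.isBracket_epsilon_isUSigma hs hs0 hσ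
  have h3 : IsBracket u (chi u s σ) (bracket u (chi u s σ)) := Classical.epsilon_spec ⟨_, h2⟩
  rwa [(hfu.existsUnique_isBracket hs hs0 hσ).unique h3 h2]

end IsHeightOnePair

/-! ### The Frobenius in characteristic `p` -/

/-- The series `x^p`. -/
def frobSeries (R : Type*) [CommRing R] (p : ℕ) [hp : Fact p.Prime] : S0 R :=
  ⟨X ^ p, by rw [map_pow, constantCoeff_X, zero_pow hp.out.ne_zero]⟩

theorem S0.map_frobSeries {R S : Type*} [CommRing R] [CommRing S] (φ : R →+* S) :
    S0.map φ (frobSeries R p) = frobSeries S p :=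
  S0.ext' (by rw [S0.map_series, frobSeries, frobSeries, map_pow, map_X])

theorem S0.substHom_injective {k : Type*} [Field k] {h : S0 k} (hh : h.series ≠ 0) :
    Function.Injective h.substHom := by
  rw [injective_iff_map_eq_zero]
  intro g hg
  by_contra hg0
  have h1 := S0.order_substHom h hg0
  rw [hg, order_zero, ← ENat.natCast_toNat (order_eq_top.not.2 hh), nsmul_eq_mul] at h1
  exact absurd h1.symm (ENat.natCast_ne_top (g.order.toNat * h.series.order.toNat))

theorem S0.mul_right_cancel {k : Type*} [Field k] {g g' h : S0 k} (hh : h.series ≠ 0)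
    (e : g * h = g' * h) : g = g' := by
  refine S0.ext' (S0.substHom_injective hh ?_)
  have := congrArg S0.series e
  rwa [S0.mul_series, S0.mul_series, ← S0.substHom_apply, ← S0.substHom_apply] at this

/-- Over the prime field, raising to the power `p` is the substitution `x ↦ x^p`. -/
theorem substHom_frobSeries {k : Type*} [CommRing k] [CharP k p] (hk : ∀ a : k, a ^ p = a)
    (g : k⟦X⟧) : (frobSeries k p).substHom g = g ^ p := by
  have : CharP k⟦X⟧ p := charP_of_injective_ringHom C_injective p
  have h : (frobSeries k p).substHom = frobenius k⟦X⟧ p := by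
    apply powerSeries_ringHom_ext
    · intro a
      rw [S0.substHom_C, frobenius_def, ← map_pow, hk]
    · rw [S0.substHom_X, frobenius_def]; rfl
    · intro r hr
      ext n
      obtain ⟨t, rfl⟩ := hr (n + 1)
      rw [S0.substHom_X, frobSeries, ← pow_mul, coeff_X_pow_mul', if_neg, map_zero]
      have := (Fact.out : p.Prime).two_le
      nlinarith
  rw [h, frobenius_def]

theorem residue_pow_card (a : IsLocalRing.ResidueField ℤ_[p]) : a ^ p = a := by
  apply (PadicInt.residueField (p := p)).injective
  rw [map_pow, ZMod.pow_card]

instance : CharP (IsLocalRing.ResidueField ℤ_[p]) p :=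
  charP_of_injective_ringHom (f := (PadicInt.residueField (p := p)).symm.toRingHom)
    (PadicInt.residueField (p := p)).symm.injective p

theorem frobSeries_mul {k : Type*} [CommRing k] [CharP k p] (hk : ∀ a : k, a ^ p = a) (g : S0 k) :
    frobSeries k p * g = g * frobSeries k p := by
  refine S0.ext' ?_
  rw [S0.mul_series, S0.mul_series, ← S0.substHom_apply, ← S0.substHom_apply,
    substHom_frobSeries hk, frobSeries, map_pow, S0.substHom_X]

/-- Reduction modulo `p` of a series without constant term. -/
abbrev S0.red : S0 ℤ_[p] →* S0 (IsLocalRing.ResidueField ℤ_[p]) :=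
  S0.map (IsLocalRing.residue ℤ_[p])

theorem red_pow_p (g : ℤ_[p]⟦X⟧) :
    red (g ^ p) = red ((frobSeries ℤ_[p] p).substHom g) := by
  rw [S0.map_substHom, S0.map_frobSeries, map_pow, substHom_frobSeries residue_pow_card]

/-- If the derivative of `f` vanishes modulo `p`, then `f(x) ≡ a(x^p) mod p`. -/
theorem red_frobQuotient_mul {f : S0 ℤ_[p]} (hf : red (derivative ℤ_[p] f.series) = 0) :
    S0.red f = S0.red (frobQuotient f) * frobSeries _ p := by
  refine S0.ext' ?_
  have hp := (Fact.out : p.Prime)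
  ext n
  rw [S0.mul_series, S0.map_series, S0.map_series, frobSeries, coeff_subst_X_pow hp.ne_zero,
    coeff_map]
  split_ifs with h
  · rw [coeff_map, frobQuotient, coeff_mk, Nat.mul_div_cancel' h]
    rfl
  · have hn : n ≠ 0 := fun h0 => h (h0 ▸ dvd_zero p)
    have h1 := congrArg (coeff (n - 1)) hf
    rw [coeff_map, coeff_derivative, Nat.sub_add_cancel (Nat.pos_of_ne_zero hn), map_zero,
      map_mul, ← Nat.cast_succ, Nat.succ_eq_add_one, Nat.sub_add_cancel (Nat.pos_of_ne_zero hn),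
      map_natCast, mul_eq_zero, CharP.cast_eq_zero_iff (IsLocalRing.ResidueField ℤ_[p]) p] at h1
    exact h1.resolve_right h

theorem frobSeries_series_ne_zero {k : Type*} [Field k] : (frobSeries k p).series ≠ 0 :=
  pow_ne_zero _ X_ne_zero

/-- A series commuting with `f` commutes with `a` modulo `p`. -/
theorem commute_red_frobQuotient {f : S0 ℤ_[p]} (hf : red (derivative ℤ_[p] f.series) = 0)
    {v : S0 ℤ_[p]} (hv : f * v = v * f) : Commute (S0.red (frobQuotient f)) (S0.red v) := by
  apply S0.mul_right_cancel (frobSeries_series_ne_zero (p := p))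
  have h := congrArg S0.red hv
  rw [map_mul, map_mul, red_frobQuotient_mul hf] at h
  rwa [mul_assoc, ← frobSeries_mul residue_pow_card, ← mul_assoc, mul_assoc (S0.red v)]

/-! ### Evaluation modulo `p` -/

/-- The value of a power series at a point of the open disc, modulo `p`. -/
def evModP (z : Disc p) : ℤ_[p]⟦X⟧ →+* ModP 𝓞_ℂ_[p] p :=
  (Ideal.Quotient.mk (Ideal.span {(p : 𝓞_ℂ_[p])})).comp (ev z)

theorem evModP_apply (z : Disc p) (g : ℤ_[p]⟦X⟧) :
    evModP z g = Ideal.Quotient.mk (Ideal.span {(p : 𝓞_ℂ_[p])}) (ev z g) := rfl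

theorem evModP_congr (z : Disc p) {g h : ℤ_[p]⟦X⟧} (e : red g = red h) :
    evModP z g = evModP z h := by
  rw [← sub_eq_zero, ← map_sub] at e ⊢
  obtain ⟨t, ht⟩ := (red_eq_zero_iff _).1 e
  rw [ht, map_mul, show C (p : ℤ_[p]) = (p : ℤ_[p]⟦X⟧) from map_natCast C p, map_natCast]
  have h0 : (p : ModP 𝓞_ℂ_[p] p) = 0 := CharP.cast_eq_zero _ p
  exact (congrArg (· * evModP z t) h0).trans (zero_mul _)

theorem evModP_substHom (z : Disc p) (h : S0 ℤ_[p]) (g : ℤ_[p]⟦X⟧) :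
    evModP z (h.substHom g) = evModP (h • z) g := by
  rw [evModP_apply, ev_substHom, evModP_apply]

theorem evModP_substHom_congr (z : Disc p) {h h' : S0 ℤ_[p]} (e : S0.red h = S0.red h')
    (g : ℤ_[p]⟦X⟧) : evModP z (h.substHom g) = evModP z (h'.substHom g) :=
  evModP_congr z (by rw [S0.map_substHom, S0.map_substHom, e])

theorem galModP_evModP (σ : Gal(PadicAlgCl p/ℚ_[p])) (z : Disc p) (g : ℤ_[p]⟦X⟧) :
    galModP σ (evModP z g) = evModP (galD σ z) g := by
  rw [evModP_apply, evModP_apply, galModP, Ideal.quotientMap_mk, ev_galD]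

/-! ### Adic completions -/

section AdicCompletion

variable {R S : Type*} [CommRing R] [CommRing S]

/-- The homomorphism from the `I`-adic completion to `S/J^n` induced by a homomorphism which maps
`I` into `J`. -/
def adicExtendMod (I : Ideal R) (J : Ideal S) (h : R →+* S) (hIJ : I ≤ J.comap h) (n : ℕ) :
    AdicCompletion I R →+* S ⧸ J ^ n :=
  (Ideal.quotientMap (J ^ n) h
    ((Ideal.pow_right_mono hIJ n).trans (Ideal.le_comap_pow h n))).comp
    (AdicCompletion.evalₐ I n).toRingHom

theorem factorPow_comp_adicExtendMod (I : Ideal R) (J : Ideal S) (h : R →+* S)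
    (hIJ : I ≤ J.comap h) {m n : ℕ} (hmn : m ≤ n) :
    (Ideal.Quotient.factorPow J hmn).comp (adicExtendMod I J h hIJ n) =
      adicExtendMod I J h hIJ m := by
  ext x
  obtain ⟨x, rfl⟩ := AdicCompletion.mk_surjective I R x
  have h1 : Ideal.Quotient.mk (I ^ m) (x.val n) = Ideal.Quotient.mk (I ^ m) (x.val m) := by
    have := x.property hmn
    rw [SModEq.sub_mem, smul_eq_mul, Ideal.mul_top] at this
    rw [eq_comm, Ideal.Quotient.mk_eq_mk_iff_sub_mem]
    exact this
  have h2 := congrArg (Ideal.quotientMap (J ^ m) h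
    ((Ideal.pow_right_mono hIJ m).trans (Ideal.le_comap_pow h m))) h1
  simpa [adicExtendMod, Ideal.quotientMap_mk] using h2

/-- The extension to the `I`-adic completion of a ring homomorphism to a `J`-adically complete
ring which maps `I` into `J`. -/
def adicExtend (I : Ideal R) (J : Ideal S) [IsAdicComplete J S] (h : R →+* S)
    (hIJ : I ≤ J.comap h) : AdicCompletion I R →+* S :=
  IsAdicComplete.liftRingHom J (adicExtendMod I J h hIJ) (factorPow_comp_adicExtendMod I J h hIJ)

theorem adicExtend_algebraMap (I : Ideal R) (J : Ideal S) [IsAdicComplete J S] (h : R →+* S)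
    (hIJ : I ≤ J.comap h) (x : R) :
    adicExtend I J h hIJ (algebraMap R (AdicCompletion I R) x) = h x := by
  rw [IsHausdorff.eq_iff_smodEq (I := J)]
  intro n
  rw [SModEq.sub_mem, smul_eq_mul, Ideal.mul_top, ← Ideal.Quotient.mk_eq_mk_iff_sub_mem,
    adicExtend, IsAdicComplete.mk_liftRingHom J _ (factorPow_comp_adicExtendMod I J h hIJ),
    adicExtendMod, RingHom.comp_apply]
  have : (AdicCompletion.evalₐ I n).toRingHom (algebraMap R (AdicCompletion I R) x) =
      Ideal.Quotient.mk (I ^ n) x := AdicCompletion.evalₐ_of I n x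
  rw [this, Ideal.quotientMap_mk]

theorem adicCompletion_exists_eq_add (r : R) (a : AdicCompletion (Ideal.span {r}) R) :
    ∃ (x : R) (b : AdicCompletion (Ideal.span {r}) R),
      a = algebraMap R _ x + algebraMap R _ r * b := by
  obtain ⟨x, hx⟩ := Ideal.Quotient.mk_surjective (AdicCompletion.evalOneₐ (Ideal.span {r}) a)
  have h : a - algebraMap R _ x ∈
      RingHom.ker (AdicCompletion.evalOneₐ (Ideal.span {r})).toRingHom := by
    rw [RingHom.mem_ker, map_sub, sub_eq_zero]
    exact hx.symm
  rw [AdicCompletion.ker_evalOneₐ_eq_map _ (Submodule.fg_span (Set.finite_singleton r)),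
    Ideal.map_span, Set.image_singleton,
    Ideal.mem_span_singleton] at h
  obtain ⟨b, hb⟩ := h
  exact ⟨x, b, by rw [← hb]; ring⟩

theorem adicCompletion_eq_zero_of_mul (r : R) (hr : ∀ x, r * x = 0 → x = 0)
    (a : AdicCompletion (Ideal.span {r}) R) (ha : algebraMap R _ r * a = 0) : a = 0 := by
  apply AdicCompletion.ext_evalₐ
  intro n
  obtain ⟨a, rfl⟩ := AdicCompletion.mk_surjective _ R a
  have h := congrArg (AdicCompletion.evalₐ (Ideal.span {r}) (n + 1)) ha
  have h0 : AdicCompletion.evalₐ (Ideal.span {r}) (n + 1) (algebraMap R _ r) =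
    Ideal.Quotient.mk _ r := AdicCompletion.evalₐ_of _ _ r
  rw [map_mul, h0, AdicCompletion.evalₐ_mk, map_zero, ← map_mul, Ideal.Quotient.eq_zero_iff_mem,
    Ideal.span_singleton_pow, Ideal.mem_span_singleton] at h
  obtain ⟨y, hy⟩ := h
  have h1 : a.val (n + 1) = r ^ n * y :=
    sub_eq_zero.1 (hr _ (by rw [mul_sub, hy]; ring))
  have h2 := a.property (Nat.le_succ n)
  rw [SModEq.sub_mem, smul_eq_mul, Ideal.mul_top] at h2
  rw [AdicCompletion.evalₐ_mk, map_zero, Ideal.Quotient.eq_zero_iff_mem]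
  have h3 : a.val (n + 1) ∈ Ideal.span {r} ^ n := by
    rw [h1, Ideal.span_singleton_pow]
    exact Ideal.mul_mem_right _ _ (Ideal.mem_span_singleton_self _)
  exact (Submodule.sub_mem_iff_left _ h3).1 h2

end AdicCompletion

/-! ### The ring `A_∞` -/

section Ainfty

variable (f : S0 ℤ_[p])

instance : IsAdicComplete (Ideal.span {(p : Ainfty f)}) (Ainfty f) := by
  have h := (IsAdicComplete.map_algebraMap_iff (Ideal.span {(p : AinftyCirc f)}) (Ainfty f)
    (S := Ainfty f)).2 (AdicCompletion.isAdicComplete (Submodule.fg_span (Set.finite_singleton _)))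
  rwa [Ideal.map_span, Set.image_singleton, map_natCast] at h

variable {f}

theorem exists_eq_evalX_add (a : Ainfty f) :
    ∃ (i : ℕ) (g : ℤ_[p]⟦X⟧) (b : Ainfty f), a = evalX f i g + p * b := by
  obtain ⟨x, b, h⟩ := adicCompletion_exists_eq_add _ a
  obtain ⟨i, g, rfl⟩ := Ring.DirectLimit.exists_of x
  rw [map_natCast] at h
  exact ⟨i, g, b, h⟩

theorem ainfty_eq_zero_of_p_mul {a : Ainfty f} (h : p * a = 0) : a = 0 := by
  refine adicCompletion_eq_zero_of_mul _ (fun x hx => ?_) a (by rwa [map_natCast])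
  obtain ⟨i, g, rfl⟩ := Ring.DirectLimit.exists_of x
  rw [← map_natCast (Ring.DirectLimit.of (fun _ : ℕ => ℤ_[p]⟦X⟧)
    (fun i j h => transition f i j h) i) p, ← map_mul] at hx
  obtain ⟨j, hij, hj⟩ := Ring.DirectLimit.of.zero_exact hx
  rw [map_mul, map_natCast, mul_eq_zero] at hj
  have hp : (p : ℤ_[p]⟦X⟧) ≠ 0 := by
    rw [← map_natCast C p, ne_eq, map_eq_zero_iff _ C_injective]
    exact_mod_cast (Fact.out : p.Prime).ne_zero
  have := congrArg (Ring.DirectLimit.of (fun _ : ℕ => ℤ_[p]⟦X⟧)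
    (fun i j h => transition f i j h) j) (hj.resolve_left hp)
  rwa [Ring.DirectLimit.of_f, map_zero] at this

theorem evalX_transition {i j : ℕ} (h : i ≤ j) (g : ℤ_[p]⟦X⟧) :
    evalX f j (transition f i j h g) = evalX f i g :=
  congrArg (algebraMap (AinftyCirc f) (Ainfty f)) (Ring.DirectLimit.of_f
    (G := fun _ : ℕ => ℤ_[p]⟦X⟧) (f := fun i j h => transition f i j h) h g)

theorem evalX_eq_evalX_succ (i : ℕ) (g : ℤ_[p]⟦X⟧) :
    evalX f i g = evalX f (i + 1) (f.substHom g) := by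
  rw [← evalX_transition (Nat.le_succ i), transition, Nat.succ_eq_add_one, Nat.add_sub_cancel_left,
    pow_one]

/-- Series which are congruent modulo `p` have congruent values at `x_i`. -/
theorem exists_evalX_eq_of_red_eq {g h : ℤ_[p]⟦X⟧} (e : red g = red h) (i : ℕ) :
    ∃ b, evalX f i g = evalX f i h + p * b := by
  rw [← sub_eq_zero, ← map_sub] at e
  obtain ⟨t, ht⟩ := (red_eq_zero_iff _).1 e
  refine ⟨evalX f i t, ?_⟩
  rw [← sub_eq_iff_eq_add', ← map_sub, ht, map_mul,
    show C (p : ℤ_[p]) = (p : ℤ_[p]⟦X⟧) from map_natCast C p, map_natCast]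

/-- Two homomorphisms from `A_∞` to `Ẽ⁺` which agree on the `x_i` are equal, provided that the
coordinates of the images of the `x_i` are nilpotent. -/
theorem ainfty_ringHom_ext {φ φ' : Ainfty f →+* Etilde p}
    (h : ∀ i, φ (xvar f i) = φ' (xvar f i))
    (hnil : ∀ i n, IsNilpotent (PreTilt.coeff n (φ (xvar f i)))) : φ = φ' := by
  have key (i : ℕ) : φ.comp (evalX f i) = φ'.comp (evalX f i) := by
    apply powerSeries_ringHom_ext
    · intro a
      exact DFunLike.congr_fun (padicInt_ringHom_ext_of_charP
        ((φ.comp (evalX f i)).comp C) ((φ'.comp (evalX f i)).comp C)) a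
    · exact h i
    · intro r hr
      apply Perfection.ext
      intro n
      obtain ⟨N, hN⟩ := hnil i n
      obtain ⟨t, rfl⟩ := hr N
      change PreTilt.coeff n (φ (xvar f i) ^ N * t) = PreTilt.coeff n 0
      rw [map_mul, map_pow, hN, zero_mul, map_zero]
  ext a
  obtain ⟨i, g, b, rfl⟩ := exists_eq_evalX_add a
  have h0 : (p : Etilde p) = 0 := CharP.cast_eq_zero _ p
  rw [map_add, map_add, map_mul, map_mul, map_natCast, map_natCast, h0, zero_mul, zero_mul]
  congr 1
  exact DFunLike.congr_fun (key i) g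

end Ainfty

/-! ### The homomorphism from `A_∞` to `Ẽ⁺` -/

theorem isNilpotent_mk_of_norm_lt_one {z : 𝓞_ℂ_[p]} (hz : ‖(z : ℂ_[p])‖ < 1) :
    IsNilpotent (Ideal.Quotient.mk (Ideal.span {(p : 𝓞_ℂ_[p])}) z) := by
  obtain ⟨N, hN⟩ := exists_pow_lt_of_lt_one (prime_inv_pos (p := p)) hz
  refine ⟨N, ?_⟩
  rw [← map_pow, Ideal.Quotient.eq_zero_iff_mem, Ideal.mem_span_singleton, integers_dvd_iff]
  push_cast
  rw [norm_pow, norm_coe_p]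
  exact hN.le

theorem mk_eq_zero_iff (z : 𝓞_ℂ_[p]) :
    Ideal.Quotient.mk (Ideal.span {(p : 𝓞_ℂ_[p])}) z = 0 ↔ (p : 𝓞_ℂ_[p]) ∣ z := by
  rw [Ideal.Quotient.eq_zero_iff_mem, Ideal.mem_span_singleton]

/-- The homomorphism to a perfection with given coordinates. -/
def perfectionMk {R S : Type*} [CommRing R] [CommRing S] [CharP S p] (θ : ℕ → R →+* S)
    (h : ∀ n r, θ (n + 1) r ^ p = θ n r) : R →+* Perfection S p where
  toFun r := ⟨fun n => θ n r, fun n => h n r⟩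
  map_zero' := Perfection.ext fun n => map_zero (θ n)
  map_one' := Perfection.ext fun n => map_one (θ n)
  map_add' a b := Perfection.ext fun n => map_add (θ n) a b
  map_mul' a b := Perfection.ext fun n => map_mul (θ n) a b

section Phi

variable {f : S0 ℤ_[p]} {s : ℕ → 𝓞_ℂ_[p]} (hs : IsConsistent f s)

include hs in
theorem IsConsistent.pow_smul_seq (i m : ℕ) : f ^ m • hs.seq (i + m) = hs.seq i := by
  induction m with
  | zero => rw [pow_zero, one_smul, add_zero]
  | succ m ih => rw [pow_succ, mul_smul, ← add_assoc, hs.smul_seq_succ, ih]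

theorem evModP_seq_succ_pow (n m : ℕ) (g : ℤ_[p]⟦X⟧) (hf : red (derivative ℤ_[p] f.series) = 0) :
    evModP (hs.seq (m + 1)) ((frobQuotient f ^ (n + 1)).substHom g) ^ p =
      evModP (hs.seq m) ((frobQuotient f ^ n).substHom g) := by
  rw [← map_pow, evModP_congr _ (red_pow_p _), ← S0.substHom_mul, ← hs.smul_seq_succ m,
    ← evModP_substHom, ← S0.substHom_mul]
  refine evModP_substHom_congr _ ?_ g
  rw [map_mul, map_mul, S0.map_frobSeries, red_frobQuotient_mul hf, map_pow, map_pow, pow_succ,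
    mul_assoc]

variable (hf : red (derivative ℤ_[p] f.series) = 0)

/-- The homomorphism `A_i → Ẽ⁺` which maps `x_i` to `π̂_i`: the `n`-th coordinate of the image of
`g` is `g(a^{∘n}(π_{i+n})) mod p`. -/
def phiLevel (i : ℕ) : ℤ_[p]⟦X⟧ →+* Etilde p :=
  perfectionMk (fun n => (evModP (hs.seq (i + n))).comp (frobQuotient f ^ n).substHom)
    fun n g => evModP_seq_succ_pow hs n (i + n) g hf

theorem coeff_phiLevel (i n : ℕ) (g : ℤ_[p]⟦X⟧) :
    PreTilt.coeff n (phiLevel hs hf i g) =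
      evModP (hs.seq (i + n)) ((frobQuotient f ^ n).substHom g) := rfl

theorem phiLevel_transition {i j : ℕ} (h : i ≤ j) (g : ℤ_[p]⟦X⟧) :
    phiLevel hs hf j (transition f i j h g) = phiLevel hs hf i g := by
  obtain ⟨m, rfl⟩ := Nat.exists_eq_add_of_le h
  refine Perfection.ext fun n => ?_
  change PreTilt.coeff n _ = PreTilt.coeff n _
  rw [coeff_phiLevel, coeff_phiLevel, transition, Nat.add_sub_cancel_left, ← S0.substHom_mul,
    ← hs.pow_smul_seq (i + n) m, ← evModP_substHom, ← S0.substHom_mul, add_right_comm]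
  refine evModP_substHom_congr _ ?_ g
  rw [map_mul, map_mul, map_pow, map_pow]
  exact ((commute_red_frobQuotient hf rfl).pow_pow n m).symm.eq

/-- The homomorphism `φ : A_∞ → Ẽ⁺` which maps `x_i` to `π̂_i` for all `i`. -/
def phi : Ainfty f →+* Etilde p :=
  adicExtend (Ideal.span {(p : AinftyCirc f)}) (⊥ : Ideal (Etilde p))
    (Ring.DirectLimit.lift _ _ (Etilde p) (phiLevel hs hf)
      fun _ _ h g => phiLevel_transition hs hf h g) (by
    rw [Ideal.span_singleton_le_iff_mem, Ideal.mem_comap, map_natCast, Ideal.mem_bot]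
    exact CharP.cast_eq_zero _ p)

theorem phi_evalX (i : ℕ) (g : ℤ_[p]⟦X⟧) : phi hs hf (evalX f i g) = phiLevel hs hf i g := by
  rw [phi, evalX, RingHom.comp_apply, adicExtend_algebraMap]
  exact Ring.DirectLimit.lift_of ..

theorem coeff_phi_xvar (i n : ℕ) : PreTilt.coeff n (phi hs hf (xvar f i)) =
    evModP (hs.seq (i + n)) (frobQuotient f ^ n).series := by
  rw [xvar, phi_evalX, coeff_phiLevel, S0.substHom_X]

theorem isReduction_phi : IsReduction f s (phi hs hf) := fun i n => coeff_phi_xvar hs hf i n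

theorem isNilpotent_coeff_phi_xvar (i n : ℕ) :
    IsNilpotent (PreTilt.coeff n (phi hs hf (xvar f i))) := by
  rw [coeff_phi_xvar]
  exact isNilpotent_mk_of_norm_lt_one ((frobQuotient f ^ n) • hs.seq (i + n)).2

theorem IsReduction.eq_phi {φ : Ainfty f →+* Etilde p} (h : IsReduction f s φ) :
    φ = phi hs hf := by
  refine (ainfty_ringHom_ext (fun i => Perfection.ext fun n => ?_)
    (isNilpotent_coeff_phi_xvar hs hf)).symm
  exact (isReduction_phi hs hf i n).trans (h i n).symm

include hs in
/-- If `p` divides `s (m + 1)`, then it divides `s 1`, hence `p²` divides `s 0 = f(s 1)`. But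
`s 0` is a root of `f(x)/x`, so that it divides the constant term of that series. -/
theorem not_dvd_seq_succ (hfE : IsEisensteinSeries f.divX) (hs0 : s 0 ≠ 0) (m : ℕ) :
    ¬ (p : 𝓞_ℂ_[p]) ∣ s (m + 1) := by
  have hnorm : ‖f.linearCoeff‖ = (p : ℝ)⁻¹ := norm_linearCoeff hfE
  have hdvd (g : ℤ_[p]⟦X⟧) (z : Disc p) : z.1 ∣ ev z g - ev z (C (constantCoeff g)) := by
    rw [← map_sub, ← ev_X z]
    exact map_dvd _ (X_dvd_iff.2 (by simp))
  have hc (z : Disc p) : ‖((ev z (C f.linearCoeff) : 𝓞_ℂ_[p]) : ℂ_[p])‖ = (p : ℝ)⁻¹ := by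
    rw [norm_ev_C, hnorm]
  have hpc (z : Disc p) : (p : 𝓞_ℂ_[p]) ∣ ev z (C f.linearCoeff) := by
    rw [integers_dvd_iff, hc]
    push_cast
    rw [norm_coe_p]
  intro h
  have h1 : (p : 𝓞_ℂ_[p]) ∣ s 1 := by
    induction m with
    | zero => exact h
    | succ m ih =>
      refine ih (h.trans ?_)
      rw [← hs.seq_val, ← hs.seq_val, ← hs.smul_seq_succ (m + 1), val_smul]
      exact dvd_mul_right _ _
  have h0 : (p : 𝓞_ℂ_[p]) * p ∣ s 0 := by
    rw [← hs.seq_val, ← hs.smul_seq_succ 0, val_smul]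
    refine mul_dvd_mul h1 ?_
    have := hdvd f.divX (hs.seq 1)
    rw [S0.constantCoeff_divX] at this
    exact (dvd_sub_left (hpc _)).1 (h1.trans this)
  have h2 := hdvd f.divX (hs.seq 0)
  rw [hs.ev_seq_zero hs0, S0.constantCoeff_divX, zero_sub, dvd_neg] at h2
  have h3 := (integers_dvd_iff _ _).1 (h0.trans h2)
  push_cast at h3
  rw [hc, norm_mul, norm_coe_p] at h3
  have := mul_lt_of_lt_one_right (prime_inv_pos (p := p)) (prime_inv_lt_one (p := p))
  linarith

theorem phiLevel_congr (i : ℕ) {g h : ℤ_[p]⟦X⟧} (e : red g = red h) :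
    phiLevel hs hf i g = phiLevel hs hf i h :=
  Perfection.ext fun _ => evModP_congr _ (by rw [S0.map_substHom, S0.map_substHom, e])

theorem isReduced_of_perfectRing (k : Type*) [CommRing k] (p : ℕ) [hp : Fact p.Prime] [CharP k p]
    [PerfectRing k p] : IsReduced k where
  eq_zero x hx := by
    obtain ⟨n, hn⟩ := hx
    have h : x ^ p ^ n = 0 := pow_eq_zero_of_le (Nat.lt_pow_self hp.out.one_lt).le hn
    refine (iterateFrobeniusEquiv k p n).injective ?_
    rw [map_zero, iterateFrobeniusEquiv_def, h]

instance : IsReduced (Etilde p) := isReduced_of_perfectRing _ p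

/-- A power series which is nonzero modulo `p` is congruent to the product of a power of `x` and of
a unit. -/
theorem exists_red_eq_X_pow_mul {g : ℤ_[p]⟦X⟧} (hg : red g ≠ 0) :
    ∃ (d : ℕ) (h : ℤ_[p]⟦X⟧), IsUnit h ∧ red g = red (X ^ d * h) := by
  obtain ⟨h, hh⟩ := map_surjective (IsLocalRing.residue ℤ_[p])
    IsLocalRing.residue_surjective (red g).divXPowOrder
  refine ⟨(red g).order.toNat, h, ?_, ?_⟩
  · rw [isUnit_iff_constantCoeff, ← isUnit_map_iff (IsLocalRing.residue ℤ_[p])]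
    have h1 := congrArg constantCoeff hh
    rw [← coeff_zero_eq_constantCoeff_apply, coeff_map, coeff_zero_eq_constantCoeff_apply] at h1
    rw [h1, isUnit_iff_ne_zero]
    exact fun h0 => hg (constantCoeff_divXPowOrder_eq_zero_iff.1 h0)
  · rw [map_mul, hh, map_pow, map_X, X_pow_order_mul_divXPowOrder]

theorem phiLevel_X_eq_zero {i : ℕ} {g : ℤ_[p]⟦X⟧} (hg : red g ≠ 0)
    (h : phiLevel hs hf i g = 0) : phiLevel hs hf i X = 0 := by
  obtain ⟨d, r, hr, e⟩ := exists_red_eq_X_pow_mul hg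
  rw [phiLevel_congr hs hf i e, map_mul, map_pow,
    (hr.map (phiLevel hs hf i)).mul_left_eq_zero] at h
  exact IsNilpotent.eq_zero ⟨d, h⟩

theorem red_eq_zero_of_phiLevel (hfE : IsEisensteinSeries f.divX) (hs0 : s 0 ≠ 0) {i : ℕ}
    {g : ℤ_[p]⟦X⟧} (h : phiLevel hs hf i g = 0) : red g = 0 := by
  by_contra hg
  have hX := phiLevel_X_eq_zero hs hf hg h
  -- the image of `x_{i+1}` vanishes as well, since `x_i = f(x_{i+1})`
  have hX1 : phiLevel hs hf (i + 1) X = 0 := by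
    refine phiLevel_X_eq_zero hs hf (red_series_ne_zero hfE) ?_
    rw [← hX, ← phiLevel_transition hs hf (Nat.le_succ i), transition, Nat.succ_eq_add_one,
      Nat.add_sub_cancel_left, pow_one, S0.substHom_X]
  have h0 := congrArg (PreTilt.coeff 0) hX1
  rw [coeff_phiLevel, pow_zero, S0.substHom_one, map_zero, evModP_apply, ev_X,
    mk_eq_zero_iff] at h0
  exact not_dvd_seq_succ hs hfE hs0 i h0

theorem ker_phi (hfE : IsEisensteinSeries f.divX) (hs0 : s 0 ≠ 0) :
    RingHom.ker (phi hs hf) = Ideal.span {(p : Ainfty f)} := by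
  have h0 : (p : Etilde p) = 0 := CharP.cast_eq_zero _ p
  ext a
  rw [RingHom.mem_ker, Ideal.mem_span_singleton]
  constructor
  · intro ha
    obtain ⟨i, g, b, rfl⟩ := exists_eq_evalX_add a
    rw [map_add, map_mul, map_natCast, h0, zero_mul, add_zero, phi_evalX] at ha
    obtain ⟨c, hc⟩ := exists_evalX_eq_of_red_eq (f := f) (h := 0)
      ((red_eq_zero_of_phiLevel hs hf hfE hs0 ha).trans (map_zero _).symm) i
    rw [hc, map_zero, zero_add, ← mul_add]
    exact dvd_mul_right _ _
  · rintro ⟨b, rfl⟩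
    rw [map_mul, map_natCast, h0, zero_mul]

end Phi

end HeightOne

namespace HeightOne

open PowerSeries

/-! ### Lifting homomorphisms to Witt vectors -/

theorem eq_zero_of_forall_natCast_pow_dvd (q : ℕ) {A : Type*} [CommRing A]
    [IsHausdorff (Ideal.span {(q : A)}) A] {a : A} (h : ∀ n : ℕ, (q : A) ^ n ∣ a) : a = 0 := by
  refine IsHausdorff.haus (I := Ideal.span {(q : A)}) inferInstance a fun n => ?_
  rw [SModEq.zero, smul_eq_mul, Ideal.mul_top, Ideal.span_singleton_pow, Ideal.mem_span_singleton]
  exact h n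

/-- A homomorphism from a `p`-adically separated ring to a `p`-torsion free ring is injective as
soon as its kernel is contained in the ideal generated by `p`. -/
theorem injective_of_ker_le {p : ℕ} {A B : Type*} [CommRing A] [CommRing B]
    [IsHausdorff (Ideal.span {(p : A)}) A] (hB : ∀ b : B, p * b = 0 → b = 0) (ψ : A →+* B)
    (hψ : ∀ a, ψ a = 0 → (p : A) ∣ a) : Function.Injective ψ := by
  rw [injective_iff_map_eq_zero]
  intro a ha
  refine eq_zero_of_forall_natCast_pow_dvd p fun n => ?_
  induction n generalizing a with
  | zero => rw [pow_zero]; exact one_dvd a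
  | succ n ih =>
    obtain ⟨b, rfl⟩ := hψ a ha
    rw [map_mul, map_natCast] at ha
    rw [pow_succ']
    exact mul_dvd_mul_left _ (ih b (hB _ ha))

variable {p : ℕ} [Fact p.Prime]

theorem wittVector_eq_zero_of_p_mul {k : Type*} [CommRing k] [CharP k p] [PerfectRing k p]
    (x : WittVector p k) (h : p * x = 0) : x = 0 :=
  WittVector.eq_zero_of_p_mul_eq_zero x (by rwa [mul_comm])

theorem wittVector_p_dvd_iff {k : Type*} [CommRing k] [CharP k p] [PerfectRing k p]
    (x : WittVector p k) : (p : WittVector p k) ∣ x ↔ x.coeff 0 = 0 := by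
  rw [← Ideal.mem_span_singleton, WittVector.mem_span_p_iff_coeff_zero_eq_zero]

theorem perfection_coeff_zero_injective {R : Type*} [CommRing R] [CharP R p] [IsReduced R] :
    Function.Injective (Perfection.coeff R p 0) := by
  rw [injective_iff_map_eq_zero]
  intro x hx
  refine Perfection.ext fun n => ?_
  rw [map_zero]
  induction n with
  | zero => exact hx
  | succ n ih =>
    refine IsReduced.eq_zero _ ⟨p, ?_⟩
    rw [Perfection.coeff_pow_p', ih]

section Lift

variable {A : Type*} [CommRing A] {E : Type*} [CommRing E] [CharP E p] [PerfectRing E p]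

/-- Two lifts to `W(E)` of a homomorphism `A → E` are equal if the Frobenius of `A/p` is
surjective: writing `a = b^{p^n} + p c`, the values of the lifts at `b^{p^n}` are congruent modulo
`p^{n+1}`. -/
theorem eq_of_constantCoeff_comp_eq [Fact (¬ IsUnit (p : A))]
    (hF : Function.Surjective (frobenius (ModP A p) p))
    {ι ι' : A →+* WittVector p E}
    (h : WittVector.constantCoeff.comp ι = WittVector.constantCoeff.comp ι') : ι = ι' := by
  have hdvd (a : A) : (p : WittVector p E) ∣ ι a - ι' a := by
    rw [wittVector_p_dvd_iff]
    change WittVector.constantCoeff (ι a - ι' a) = 0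
    rw [map_sub, sub_eq_zero]
    exact DFunLike.congr_fun h a
  ext1 a
  rw [← sub_eq_zero]
  refine eq_zero_of_forall_natCast_pow_dvd p fun n => ?_
  induction n generalizing a with
  | zero => rw [pow_zero]; exact one_dvd _
  | succ n ih =>
    obtain ⟨b, hb⟩ := hF.iterate n (Ideal.Quotient.mk (Ideal.span {(p : A)}) a)
    obtain ⟨b, rfl⟩ := Ideal.Quotient.mk_surjective b
    rw [iterate_frobenius, ← map_pow, eq_comm] at hb
    obtain ⟨c, hc⟩ := Ideal.mem_span_singleton.1 ((Ideal.Quotient.mk_eq_mk_iff_sub_mem _ _).1 hb)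
    rw [sub_eq_iff_eq_add.1 hc]
    have h1 : ι (p * c + b ^ p ^ n) - ι' (p * c + b ^ p ^ n) =
        p * (ι c - ι' c) + (ι b ^ p ^ n - ι' b ^ p ^ n) := by
      simp only [map_add, map_mul, map_pow, map_natCast]
      ring
    rw [h1]
    refine dvd_add ?_ (dvd_sub_pow_of_dvd_sub (hdvd b) n)
    rw [pow_succ']
    exact mul_dvd_mul_left _ (ih c)

/-- A `p`-torsion free and `p`-adically complete ring `A` such that `A/p` is perfect is a ring of
Witt vectors by Fontaine's homomorphism `θ : W(A^♭) → A`, so that every homomorphism from `A/p` to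
a perfect ring `E` lifts to a homomorphism from `A` to `W(E)`. The hypothesis on `A/p` is
expressed by the surjectivity of its Frobenius and an injective homomorphism to a reduced ring. -/
theorem exists_constantCoeff_comp_eq [Fact (¬ IsUnit (p : A))]
    [IsAdicComplete (Ideal.span {(p : A)}) A]
    (hA : ∀ a : A, p * a = 0 → a = 0) (hF : Function.Surjective (frobenius (ModP A p) p))
    (φ : A →+* E) (hφ : RingHom.ker φ = Ideal.span {(p : A)}) :
    ∃ ι : A →+* WittVector p E, WittVector.constantCoeff.comp ι = φ := by
  let φ' : ModP A p →+* E := Ideal.Quotient.lift _ φ fun a ha => by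
    rwa [← hφ, RingHom.mem_ker] at ha
  have hφ' : Function.Injective φ' := by
    rw [injective_iff_map_eq_zero]
    intro a ha
    obtain ⟨a, rfl⟩ := Ideal.Quotient.mk_surjective a
    rw [Ideal.Quotient.eq_zero_iff_mem, ← hφ]
    exact ha
  have : IsReduced E := isReduced_of_perfectRing E p
  have : IsReduced (ModP A p) := isReduced_of_injective φ' hφ'
  have hθ : Function.Bijective (WittVector.fontaineTheta A p) := by
    refine ⟨injective_of_ker_le hA _ fun x hx => ?_, surjective_fontaineTheta hF⟩
    rw [wittVector_p_dvd_iff]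
    apply perfection_coeff_zero_injective (R := ModP A p) (p := p)
    have := WittVector.mk_fontaineTheta x
    rw [hx, map_zero] at this
    exact this.symm.trans (map_zero (Perfection.coeff (ModP A p) p 0)).symm
  let e := RingEquiv.ofBijective _ hθ
  refine ⟨(WittVector.map (φ'.comp (PreTilt.coeff 0))).comp e.symm.toRingHom, ?_⟩
  ext a
  obtain ⟨x, rfl⟩ := e.surjective a
  have h1 : e.symm.toRingHom (e x) = x := e.symm_apply_apply x
  rw [RingHom.comp_apply, RingHom.comp_apply, h1, WittVector.constantCoeff_apply,
    WittVector.map_coeff, RingHom.comp_apply, ← WittVector.mk_fontaineTheta]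
  rfl

/-- A lift to `W(E)` of a homomorphism with kernel `p A` is injective. -/
theorem injective_of_constantCoeff_comp_eq [IsHausdorff (Ideal.span {(p : A)}) A]
    {φ : A →+* E} (hφ : RingHom.ker φ = Ideal.span {(p : A)}) {ι : A →+* WittVector p E}
    (h : WittVector.constantCoeff.comp ι = φ) : Function.Injective ι := by
  refine injective_of_ker_le wittVector_eq_zero_of_p_mul ι fun a ha => ?_
  rw [← Ideal.mem_span_singleton, ← hφ, RingHom.mem_ker, ← h, RingHom.comp_apply, ha, map_zero]

end Lift

/-! ### Endomorphisms of `A_∞` -/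

/-- `x_i = f(x_{i+1}) ≡ a(x_{i+1})^p` modulo `p`, so that the Frobenius of `A_∞/p` is
surjective. -/
theorem surjective_frobenius_ainfty {f : S0 ℤ_[p]} [Fact (¬ IsUnit (p : Ainfty f))]
    (hf : red (derivative ℤ_[p] f.series) = 0) :
    Function.Surjective (frobenius (ModP (Ainfty f) p) p) := by
  intro a
  obtain ⟨a, rfl⟩ := Ideal.Quotient.mk_surjective a
  obtain ⟨i, g, b, rfl⟩ := exists_eq_evalX_add a
  refine ⟨Ideal.Quotient.mk _ (evalX f (i + 1) ((frobQuotient f).substHom g)), ?_⟩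
  have e : red (f.substHom g) = red ((frobQuotient f).substHom g ^ p) := by
    rw [red_pow_p, ← S0.substHom_mul, S0.map_substHom, S0.map_substHom, map_mul, S0.map_frobSeries,
      red_frobQuotient_mul hf]
  obtain ⟨c, hc⟩ := exists_evalX_eq_of_red_eq (f := f) e (i + 1)
  rw [frobenius_def, ← map_pow, evalX_eq_evalX_succ i g, hc, ← map_pow, eq_comm,
    Ideal.Quotient.mk_eq_mk_iff_sub_mem, Ideal.mem_span_singleton]
  exact ⟨c + b, by ring⟩

/-- The endomorphism of `A_∞` induced by a series `v` commuting with `f`, which maps `x_i` to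
`v(x_i)` for all `i`. -/
theorem exists_ainfty_endomorphism {f v : S0 ℤ_[p]} (h : f * v = v * f) :
    ∃ U : Ainfty f →+* Ainfty f, ∀ i g, U (evalX f i g) = evalX f i (v.substHom g) := by
  refine ⟨adicExtend (Ideal.span {(p : AinftyCirc f)}) (Ideal.span {(p : Ainfty f)})
    (Ring.DirectLimit.lift _ _ (Ainfty f) (fun i => (evalX f i).comp v.substHom)
      fun i j hij g => ?_) ?_, fun i g => ?_⟩
  · rw [RingHom.comp_apply, RingHom.comp_apply, ← evalX_transition hij (v.substHom g), transition,
      ← S0.substHom_mul, ← S0.substHom_mul, ((show Commute f v from h).pow_left (j - i)).eq]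
  · rw [Ideal.span_singleton_le_iff_mem, Ideal.mem_comap, map_natCast]
    exact Ideal.mem_span_singleton_self _
  · rw [evalX, RingHom.comp_apply, adicExtend_algebraMap]
    exact Ring.DirectLimit.lift_of ..

/-- On `Ẽ⁺`, the action of `σ` is compatible with the endomorphism of `A_∞` induced by `v` if `σ`
acts on the sequence `s` as `v` does. -/
theorem galE_comp_phi {f v : S0 ℤ_[p]} {s : ℕ → 𝓞_ℂ_[p]} (hs : IsConsistent f s)
    (hf : red (derivative ℤ_[p] f.series) = 0) (h : f * v = v * f)
    {σ : Gal(PadicAlgCl p/ℚ_[p])} (hσ : ∀ i, v • hs.seq i = galD σ (hs.seq i))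
    {U : Ainfty f →+* Ainfty f} (hU : ∀ i g, U (evalX f i g) = evalX f i (v.substHom g)) :
    (galE σ).comp (phi hs hf) = (phi hs hf).comp U := by
  have hc (i n : ℕ) : PreTilt.coeff n (galE σ (phi hs hf (xvar f i))) =
      galModP σ (PreTilt.coeff n (phi hs hf (xvar f i))) :=
    Perfection.coeff_map ..
  refine ainfty_ringHom_ext (fun i => Perfection.ext fun n => ?_) fun i n => ?_
  · change PreTilt.coeff n _ = PreTilt.coeff n _
    rw [RingHom.comp_apply, RingHom.comp_apply, hc, coeff_phi_xvar, galModP_evModP, ← hσ,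
      ← evModP_substHom, xvar, hU, phi_evalX, coeff_phiLevel, S0.substHom_X,
      ← S0.substHom_X (frobQuotient f ^ n), ← S0.substHom_X v, ← S0.substHom_mul,
      ← S0.substHom_mul]
    refine evModP_substHom_congr _ ?_ X
    rw [map_mul, map_mul, map_pow]
    exact ((commute_red_frobQuotient hf h).pow_left n).eq
  · rw [RingHom.comp_apply, hc]
    exact (isNilpotent_coeff_phi_xvar hs hf i n).map _

end HeightOne

end

open HeightOne in
/-- The Galois action on the universal ring of `f`-consistent sequences. -/
theorem proposition3p5 (p : ℕ) [Fact p.Prime] (f : S0 ℤ_[p]) (u : (S0 ℤ_[p])ˣ)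
    (hfu : IsHeightOnePair f u) (s : ℕ → 𝓞_ℂ_[p]) (hs : IsConsistent f s) (hs0 : s 0 ≠ 0) :
    ∃ φ : Ainfty f →+* Etilde p,
      (IsReduction f s φ ∧ ∀ φ', IsReduction f s φ' → φ' = φ) ∧
      RingHom.ker φ = Ideal.span {(p : Ainfty f)} ∧
      ∃ ι : Ainfty f →+* Atilde p,
        (WittVector.constantCoeff.comp ι = φ ∧
          ∀ ι' : Ainfty f →+* Atilde p, WittVector.constantCoeff.comp ι' = φ → ι' = ι) ∧
        Function.Injective ι ∧
        ∀ σ : Gal(PadicAlgCl p/ℚ_[p]), InGK u s σ →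
          (∃! v, IsUSigma u s σ v) ∧
          (∃! v, IsBracket u (chi u s σ) v) ∧
          (∀ y : Ainfty f, galA σ (ι y) ∈ ι.range) ∧
          ∀ i : ℕ, galA σ (ι (xvar f i)) = ι (evalX f i (bracket u (chi u s σ)).series) := by
  have hfE := hfu.isEisensteinSeries_divX
  have hf := red_derivative_eq_zero hfE hfu.comm hfu.infinite_order
  have hker := ker_phi hs hf hfE hs0
  have hunit : Fact (¬ IsUnit (p : Ainfty f)) := ⟨fun h => by
    have h1 := h.map (phi hs hf)
    rw [map_natCast, show (p : Etilde p) = 0 from CharP.cast_eq_zero _ p] at h1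
    have := CharP.nontrivial_of_char_ne_one (R := Etilde p) (Fact.out : p.Prime).ne_one
    exact not_isUnit_zero h1⟩
  have hF := surjective_frobenius_ainfty hf
  obtain ⟨ι, hι⟩ := exists_constantCoeff_comp_eq (fun _ => ainfty_eq_zero_of_p_mul) hF _ hker
  refine ⟨phi hs hf, ⟨isReduction_phi hs hf, fun φ' h => h.eq_phi hs hf⟩, hker, ι,
    ⟨hι, fun ι' h => eq_of_constantCoeff_comp_eq hF (h.trans hι.symm)⟩,
    injective_of_constantCoeff_comp_eq hker hι, fun σ hσ =>
    ⟨hfu.existsUnique_isUSigma hs hs0 hσ, hfu.existsUnique_isBracket hs hs0 hσ, ?_⟩⟩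
  have hv := (isUSigma_iff hs).1 (hfu.isUSigma_bracket hs hs0 hσ)
  have hcomm := commute_of_mem_zpIterates hfu.comm hv.1
  obtain ⟨U, hU⟩ := exists_ainfty_endomorphism hcomm
  -- both sides lift the same homomorphism to `Ẽ⁺`
  have key : (galA σ).comp ι = ι.comp U := by
    refine eq_of_constantCoeff_comp_eq hF ?_
    have h1 : WittVector.constantCoeff.comp (galA σ) = (galE σ).comp WittVector.constantCoeff :=
      RingHom.ext fun y => WittVector.map_coeff (galE σ) y 0
    rw [← RingHom.comp_assoc, h1, RingHom.comp_assoc, hι, galE_comp_phi hs hf hcomm hv.2 hU,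
      ← RingHom.comp_assoc, hι]
  refine ⟨fun y => ⟨U y, (DFunLike.congr_fun key y).symm⟩, fun i => ?_⟩
  refine (DFunLike.congr_fun key _).trans ?_
  rw [RingHom.comp_apply, xvar, hU, S0.substHom_X]
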